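/- Let $n,m\ge 1$, let $A\in\mathbb{R}^{m\times m}$ and $C\in\mathbb{R}^{n\times n}$ be symmetric, $B\in\mathbb{R}^{n\times m}$, $z^*=(x^*,y^*)\in\mathbb{R}^n\times\mathbb{R}^m$, and $$f(x;y)=-\tfrac12(y-y^*)^\top A(y-y^*)+(x-x^*)^\top B(y-y^*)+\tfrac12(x-x^*)^\top C(x-x^*).$$ Assume $\mu I\le A\le LI$, $\|B\|_2,\|C\|_2\le L$ and $C+BA^{-1}B^\top\ge\mu_xI$, where $\mu>0$ and $0<\mu_x\le L$. Put $\kappa=L/\mu$ and $\kappa_x=L/\mu_x$, let $r\ge 2\kappa$, and use the stepsizes $\eta_x=\frac1{4rL}$, $\eta_y=\frac1{4L}$. Let $M=\begin{pmatrix}-C&-B\\ rB^\top&-rA\end{pmatrix}=P^{-1}JP$ be a Jordan decomposition over $\mathbb{C}$, normalized so that the nonzero superdiagonal entries of $J$ are equal to some $\delta\in(0,\mu_x/64]$. (Every $M$ has such a decomposition for every such $\delta$; if $M$ is diagonalizable, $M=P^{-1}JP$ may be any eigenvalue decomposition and $\delta$ plays no role.) Let $C_P=\|P\|_2\|P^{-1}\|_2$.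 The $j$-th call of a stochastic gradient oracle with mini-batch size $S\ge1$, at a query point $z$, returns $(g_x(z),g_y(z))$ at the cost of $S$ gradient evaluations. For the noises $\xi_x=g_x(z)-\nabla_xf(z)$ and $\xi_y=g_y(z)-\nabla_yf(z)$ of the calls that the algorithm makes, assume $\mathbb{E}\,\xi_x=0$, $\mathbb{E}\,\xi_y=0$, $\mathbb{E}\|\xi_x\|_2^2\le\sigma^2/S$, $\mathbb{E}\|\xi_y\|_2^2\le\sigma^2/S$ ($\sigma\ge0$), and that the noises $(\xi_x,\xi_y)$ of different calls are independent. From a deterministic $z^0$, SGDA iterates $x^{k+1}=x^k-\eta_xg_x(z^k)$, $y^{k+1}=y^k+\eta_yg_y(z^k)$. Stochastic EG first computes $x^{k+1/2}=x^k-\eta_xg_x(z^k)$, $y^{k+1/2}=y^k+\eta_yg_y(z^k)$, and then $x^{k+1}=x^k-\eta_xg_x(z^{k+1/2})$, $y^{k+1}=y^k+\eta_yg_y(z^{k+1/2})$, with a new oracle call at $z^{k+1/2}$. Then there are numerical constants $0<c_1\le1$ and $c_2,c_3>0$ such that the following hold in every such setting, both for SGDA and for stochastic EG. 1. For all $T\ge0$,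 $$\mathbb{E}\|z^T-z^*\|_2^2\le C_P^2\Big(1-\frac{c_1}{r\kappa_x}\Big)^{2T}\|z^0-z^*\|_2^2+\frac{c_2\,r\kappa_xC_P^2\sigma^2}{L^2S}.$$ 2. For every $\epsilon>0$ there are a number of steps $T$ and a batch size $S$, chosen independently of the oracle, such that $\mathbb{E}\|z^T-z^*\|_2\le\epsilon$ for every oracle of batch size $S$ that satisfies the noise assumption, while the total number of gradient evaluations ($TS$ for SGDA, $2TS$ for EG) is at most $$c_3\,r\kappa_x\max\Big\{1,\log\frac{C_P\|z^0-z^*\|_2}{\epsilon}\Big\}\max\Big\{1,\frac{r\kappa_xC_P^2\sigma^2}{L^2\epsilon^2}\Big\}$$ (with $\log 0$ read as $-\infty$ if $z^0=z^*$). -/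

import Mathlib

open MeasureTheory ProbabilityTheory
open scoped Matrix Matrix.Norms.L2Operator

universe u

noncomputable section

namespace QuadMinimax

/-- The Euclidean space in which the min player (or the max player) moves. -/
abbrev Eucl (n : ℕ) : Type := EuclideanSpace ℝ (Fin n)

variable {n m : ℕ}

/-- The quadratic objective
`f(x; y) = -1/2 (y - y*)ᵀ A (y - y*) + (x - x*)ᵀ B (y - y*) + 1/2 (x - x*)ᵀ C (x - x*)`. -/
def quadFun (A : Matrix (Fin m) (Fin m) ℝ) (B : Matrix (Fin n) (Fin m) ℝ)
    (C : Matrix (Fin n) (Fin n) ℝ) (zs : Eucl n × Eucl m) (x : Eucl n) (y : Eucl m) : ℝ :=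
  -(1 / 2) * ((y - zs.2).ofLp ⬝ᵥ (A *ᵥ (y - zs.2).ofLp))
    + (x - zs.1).ofLp ⬝ᵥ (B *ᵥ (y - zs.2).ofLp)
    + (1 / 2) * ((x - zs.1).ofLp ⬝ᵥ (C *ᵥ (x - zs.1).ofLp))

/-- The assumptions on a quadratic nonconvex-strongly-concave function: `A`, `C` are symmetric,
`μ I ≤ A ≤ L I`, `‖B‖₂ ≤ L`, `‖C‖₂ ≤ L` (spectral norms), and the Schur complement satisfies
`C + B A⁻¹ Bᵀ ≥ μ_x I` with `0 < μ_x ≤ L`. -/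
structure IsQuadNCSC (A : Matrix (Fin m) (Fin m) ℝ) (B : Matrix (Fin n) (Fin m) ℝ)
    (C : Matrix (Fin n) (Fin n) ℝ) (L μ μx : ℝ) : Prop where
  symm_A : A.IsSymm
  symm_C : C.IsSymm
  mu_pos : 0 < μ
  mu_le_A : (A - μ • (1 : Matrix (Fin m) (Fin m) ℝ)).PosSemidef
  A_le_L : (L • (1 : Matrix (Fin m) (Fin m) ℝ) - A).PosSemidef
  norm_B_le : ‖B‖ ≤ L
  norm_C_le : ‖C‖ ≤ L
  mux_pos : 0 < μx
  mux_le_L : μx ≤ L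
  mux_le_schur : (C + B * A⁻¹ * Bᵀ - μx • (1 : Matrix (Fin n) (Fin n) ℝ)).PosSemidef

/-- The matrix `M = [[-C, -B], [r Bᵀ, -r A]]` governing the dynamics. -/
def matM (A : Matrix (Fin m) (Fin m) ℝ) (B : Matrix (Fin n) (Fin m) ℝ)
    (C : Matrix (Fin n) (Fin n) ℝ) (r : ℝ) : Matrix (Fin n ⊕ Fin m) (Fin n ⊕ Fin m) ℝ :=
  Matrix.fromBlocks (-C) (-B) (r • Bᵀ) (-(r • A))

/-- `J` is in Jordan normal form, up to the choice of `δ` in place of `1` as the value of the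
nonzero entries above the diagonal: `J` vanishes off the diagonal and the first superdiagonal, and
each superdiagonal entry is either `0` (a block boundary) or `δ` (between two equal diagonal
entries). A diagonal matrix has this form for every `δ`. -/
structure IsJordanForm {N : ℕ} (J : Matrix (Fin N) (Fin N) ℂ) (δ : ℝ) : Prop where
  off_eq_zero : ∀ i j : Fin N, (j : ℕ) ≠ i → (j : ℕ) ≠ i + 1 → J i j = 0
  super : ∀ i j : Fin N, (j : ℕ) = i + 1 → J i j = 0 ∨ (J i j = (δ : ℂ) ∧ J i i = J j j)

/-- `M = P⁻¹ J P` is a Jordan decomposition over `ℂ`, with `δ` above the diagonal in the blocks.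
The `n + m` coordinates are numbered in the usual order, those of `x` first. -/
def IsJordanDecomp (M : Matrix (Fin n ⊕ Fin m) (Fin n ⊕ Fin m) ℝ)
    (P J : Matrix (Fin (n + m)) (Fin (n + m)) ℂ) (δ : ℝ) : Prop :=
  IsUnit P.det ∧ IsJordanForm J δ ∧
    (Matrix.reindex finSumFinEquiv finSumFinEquiv M).map (fun t : ℝ => (t : ℂ)) = P⁻¹ * J * P

/-- The condition number `C_P = ‖P‖₂ ‖P⁻¹‖₂` (spectral norms). -/
def condNum {N : ℕ} (P : Matrix (Fin N) (Fin N) ℂ) : ℝ :=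
  ‖P‖ * ‖P⁻¹‖

/-- The `ℓ₂` distance of two points of `ℝⁿ × ℝᵐ = ℝⁿ⁺ᵐ`. -/
def dist2 (z w : Eucl n × Eucl m) : ℝ := ‖WithLp.toLp 2 (z - w)‖

/-- The pair of partial gradients `(∇ₓ f(x; y), ∇_y f(x; y))` at `z = (x, y)`. -/
def partialGrads (f : Eucl n → Eucl m → ℝ) (z : Eucl n × Eucl m) : Eucl n × Eucl m :=
  (gradient (fun x => f x z.2) z.1, gradient (fun y => f z.1 y) z.2)

/-- Descent in `x` and ascent in `y` from `z` along the gradient estimate `v`. -/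
def descentAscent (ηx ηy : ℝ) (z v : Eucl n × Eucl m) : Eucl n × Eucl m :=
  (z.1 - ηx • v.1, z.2 + ηy • v.2)

/-- A stochastic gradient oracle: `g j ω z` is the estimate `(g_x(z), g_y(z))` returned by the
`j`-th call, at the query point `z`, for the outcome `ω`. -/
abbrev Oracle (Ω : Type u) (n m : ℕ) : Type u := ℕ → Ω → Eucl n × Eucl m → Eucl n × Eucl m

variable {Ω : Type u}

/-- The iterates of stochastic GDA; step `k` uses oracle call number `k`. -/
def sgda (g : Oracle Ω n m) (ηx ηy : ℝ) (z₀ : Eucl n × Eucl m) : ℕ → Ω → Eucl n × Eucl m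
  | 0, _ => z₀
  | k + 1, ω =>
      descentAscent ηx ηy (sgda g ηx ηy z₀ k ω) (g k ω (sgda g ηx ηy z₀ k ω))

/-- The iterates of stochastic EG; step `k` uses oracle call number `2k` at `z^k`
and oracle call number `2k + 1` at the extrapolated point `z^{k+1/2}`. -/
def seg (g : Oracle Ω n m) (ηx ηy : ℝ) (z₀ : Eucl n × Eucl m) : ℕ → Ω → Eucl n × Eucl m
  | 0, _ => z₀
  | k + 1, ω =>
      descentAscent ηx ηy (seg g ηx ηy z₀ k ω)
        (g (2 * k + 1) ω
          (descentAscent ηx ηy (seg g ηx ηy z₀ k ω) (g (2 * k) ω (seg g ηx ηy z₀ k ω))))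

/-- The extrapolated points `z^{k+1/2}` of stochastic EG. -/
def segHalf (g : Oracle Ω n m) (ηx ηy : ℝ) (z₀ : Eucl n × Eucl m) (k : ℕ) (ω : Ω) :
    Eucl n × Eucl m :=
  descentAscent ηx ηy (seg g ηx ηy z₀ k ω) (g (2 * k) ω (seg g ηx ηy z₀ k ω))

/-- The query point of the `j`-th oracle call of stochastic EG, i.e. `z^{j/2}`. -/
def segQuery (g : Oracle Ω n m) (ηx ηy : ℝ) (z₀ : Eucl n × Eucl m) (j : ℕ) (ω : Ω) :
    Eucl n × Eucl m :=
  if j % 2 = 0 then seg g ηx ηy z₀ (j / 2) ω else segHalf g ηx ηy z₀ (j / 2) ω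

/-- The gradient noise `(ξ_x, ξ_y) = (g_x(z) - ∇ₓ f(z), g_y(z) - ∇_y f(z))` of the `j`-th oracle
call, made at the (random) query point `q j`. -/
def gradNoise (f : Eucl n → Eucl m → ℝ) (g : Oracle Ω n m) (q : ℕ → Ω → Eucl n × Eucl m)
    (j : ℕ) (ω : Ω) : Eucl n × Eucl m :=
  g j ω (q j ω) - partialGrads f (q j ω)

/-- The assumption on the gradient noise, for mini-batches of size `S`: zero mean, second moments
at most `σ²/S`, and independence of the noises of different calls. -/
structure NoiseAssumption [MeasurableSpace Ω] (ν : Measure Ω) (ξ : ℕ → Ω → Eucl n × Eucl m)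
    (σ : ℝ) (S : ℕ) : Prop where
  memLp_x : ∀ j, MemLp (fun ω => (ξ j ω).1) 2 ν
  memLp_y : ∀ j, MemLp (fun ω => (ξ j ω).2) 2 ν
  mean_x : ∀ j, ∫ ω, (ξ j ω).1 ∂ν = 0
  mean_y : ∀ j, ∫ ω, (ξ j ω).2 ∂ν = 0
  second_moment_x : ∀ j, ∫ ω, ‖(ξ j ω).1‖ ^ 2 ∂ν ≤ σ ^ 2 / S
  second_moment_y : ∀ j, ∫ ω, ‖(ξ j ω).2‖ ^ 2 ∂ν ≤ σ ^ 2 / S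
  indep : iIndepFun ξ ν

end QuadMinimax

end

noncomputable section

namespace QuadMinimax

/-! ### Dot products, Euclidean norms and spectral norms -/

section Forms

variable {n m : ℕ}

/-! Since `f` is quadratic and `η_y = r η_x`, the error `e = z - z*` evolves linearly: with `η =
η_x`, a step multiplies `e` by `1 + ηM` for GDA and by `1 + ηM + (ηM)²` for EG, and adds a linear
image of fresh centred noise. In the coordinates `P e` the matrix `M` becomes `J`, a diagonal matrix
plus a superdiagonal part of norm at most `δ`, so both multipliers are contractions of the norm `‖P
·‖` once the eigenvalues of `M` are located. Passing to this norm and back costs the factor `C_P`.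

Location of the spectrum (`IsEigenPair.eigenvalue_bounds`). If an eigenvalue is real and exceeds
`-μ_x`, eliminating `Bᵀu` from the eigenvector equations contradicts the Schur complement bound. If
it is not real, the imaginary parts of the two tested equations force `‖v‖² = r ‖u‖²`; then `A`
outweighs `C` because `r ≥ 2κ`, which gives `Re λ ≤ -L/2` and `|λ|² ≤ 4rL (-Re λ)`. A bound on the
norm of `M` controls `|λ|`. After scaling by `η = 1/(4rL)` these are the conditions `StableAt` with
`x = 1/(r κ_x)`, and both steps contract by `1 - x/40`.

Stochastic part (`linear_iteration_bound`). The current error is an affine function of earlier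
noises, hence uncorrelated with the next one. The cross term vanishes, and the second moment
satisfies `a_{k+1} ≤ ρ² a_k + τ`, a geometric recursion. The complexity bound makes the initial
error small through `T` and the noise term small through `S`. -/

theorem dotProduct_eq_norm_sq (v : Fin n → ℝ) : v ⬝ᵥ v = ‖WithLp.toLp 2 v‖ ^ 2 := by
  rw [EuclideanSpace.real_norm_sq_eq]
  simp [dotProduct, pow_two]

theorem abs_dotProduct_le (u v : Fin n → ℝ) :
    |u ⬝ᵥ v| ≤ ‖WithLp.toLp 2 u‖ * ‖WithLp.toLp 2 v‖ := by
  have h := abs_real_inner_le_norm (WithLp.toLp 2 u) (WithLp.toLp 2 v)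
  rwa [EuclideanSpace.inner_toLp_toLp, star_trivial, dotProduct_comm] at h

theorem dotProduct_self_nonneg' (v : Fin n → ℝ) : 0 ≤ v ⬝ᵥ v := by
  rw [dotProduct_eq_norm_sq]; positivity

theorem dotProduct_mulVec_transpose (B : Matrix (Fin n) (Fin m) ℝ) (u : Fin n → ℝ)
    (v : Fin m → ℝ) : v ⬝ᵥ (Bᵀ *ᵥ u) = u ⬝ᵥ (B *ᵥ v) := by
  rw [Matrix.mulVec_transpose, dotProduct_comm, Matrix.dotProduct_mulVec]

theorem dotProduct_mulVec_symm {C : Matrix (Fin n) (Fin n) ℝ} (hC : C.IsSymm)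
    (u v : Fin n → ℝ) : u ⬝ᵥ (C *ᵥ v) = v ⬝ᵥ (C *ᵥ u) := by
  conv_lhs => rw [← hC.eq]
  exact dotProduct_mulVec_transpose C v u

theorem mulVec_dotProduct_mulVec_le {B : Matrix (Fin n) (Fin m) ℝ} {L : ℝ} (hB : ‖B‖ ≤ L)
    (v : Fin m → ℝ) : (B *ᵥ v) ⬝ᵥ (B *ᵥ v) ≤ L ^ 2 * (v ⬝ᵥ v) := by
  rw [dotProduct_eq_norm_sq, dotProduct_eq_norm_sq, ← mul_pow]
  have := Matrix.l2_opNorm_mulVec B (WithLp.toLp 2 v)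
  gcongr
  exact this.trans (by gcongr)

theorem transpose_mulVec_dotProduct_mulVec_le {B : Matrix (Fin n) (Fin m) ℝ} {L : ℝ}
    (hB : ‖B‖ ≤ L) (u : Fin n → ℝ) : (Bᵀ *ᵥ u) ⬝ᵥ (Bᵀ *ᵥ u) ≤ L ^ 2 * (u ⬝ᵥ u) := by
  apply mulVec_dotProduct_mulVec_le
  rwa [← Matrix.conjTranspose_eq_transpose_of_trivial, Matrix.l2_opNorm_conjTranspose]

theorem abs_quadForm_le {C : Matrix (Fin n) (Fin n) ℝ} {L : ℝ} (hC : ‖C‖ ≤ L)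
    (u : Fin n → ℝ) : |u ⬝ᵥ (C *ᵥ u)| ≤ L * (u ⬝ᵥ u) := by
  refine (abs_dotProduct_le _ _).trans ?_
  have := Matrix.l2_opNorm_mulVec C (WithLp.toLp 2 u)
  have h2 : ‖WithLp.toLp 2 (C *ᵥ u)‖ ≤ L * ‖WithLp.toLp 2 u‖ := this.trans (by gcongr)
  calc _ ≤ ‖WithLp.toLp 2 u‖ * (L * ‖WithLp.toLp 2 u‖) := by gcongr
    _ = _ := by rw [dotProduct_eq_norm_sq]; ring

end Forms

/-! ### Consequences of the assumptions on `A`, `B`, `C`; real eigenvalues -/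

namespace IsQuadNCSC

variable {n m : ℕ} {A : Matrix (Fin m) (Fin m) ℝ} {B : Matrix (Fin n) (Fin m) ℝ}
  {C : Matrix (Fin n) (Fin n) ℝ} {L μ μx : ℝ}

theorem L_pos (h : IsQuadNCSC A B C L μ μx) : 0 < L := h.mux_pos.trans_le h.mux_le_L

theorem mu_mul_le (h : IsQuadNCSC A B C L μ μx) (v : Fin m → ℝ) :
    μ * (v ⬝ᵥ v) ≤ v ⬝ᵥ (A *ᵥ v) := by
  have := h.mu_le_A.dotProduct_mulVec_nonneg v
  simp [Matrix.sub_mulVec, dotProduct_sub, Matrix.smul_mulVec] at this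
  linarith

theorem le_L_mul (h : IsQuadNCSC A B C L μ μx) (v : Fin m → ℝ) :
    v ⬝ᵥ (A *ᵥ v) ≤ L * (v ⬝ᵥ v) := by
  have := h.A_le_L.dotProduct_mulVec_nonneg v
  simp [Matrix.sub_mulVec, dotProduct_sub, Matrix.smul_mulVec] at this
  linarith

theorem mu_le_L (h : IsQuadNCSC A B C L μ μx) (hm : 0 < m) : μ ≤ L := by
  have h1 := (h.mu_mul_le (Pi.single ⟨0, hm⟩ 1)).trans (h.le_L_mul (Pi.single ⟨0, hm⟩ 1))
  simpa using h1

/-- `A² ≤ L A`, from `L A (L - A) = A (L - A) A + (L - A) A (L - A)`. -/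
theorem mulVec_A_sq_le (h : IsQuadNCSC A B C L μ μx) (v : Fin m → ℝ) :
    (A *ᵥ v) ⬝ᵥ (A *ᵥ v) ≤ L * (v ⬝ᵥ (A *ᵥ v)) := by
  have hL := h.L_pos
  set w := A *ᵥ v with hw
  have h1 := h.le_L_mul w
  have h2 := h.mu_mul_le (L • v - w)
  have h3 : 0 ≤ μ * ((L • v - w) ⬝ᵥ (L • v - w)) :=
    mul_nonneg h.mu_pos.le (dotProduct_self_nonneg' _)
  have h4 : v ⬝ᵥ (A *ᵥ w) = w ⬝ᵥ w := by rw [dotProduct_mulVec_symm h.symm_A, ← hw]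
  have h5 : w ⬝ᵥ v = v ⬝ᵥ w := dotProduct_comm _ _
  simp only [Matrix.mulVec_sub, Matrix.mulVec_smul, ← hw, dotProduct_sub, sub_dotProduct,
    dotProduct_smul, smul_dotProduct, smul_eq_mul, h4] at h2 h3
  nlinarith

theorem mulVec_A_sq_le' (h : IsQuadNCSC A B C L μ μx) (v : Fin m → ℝ) :
    (A *ᵥ v) ⬝ᵥ (A *ᵥ v) ≤ L ^ 2 * (v ⬝ᵥ v) := by
  have h1 := h.mulVec_A_sq_le v
  have h2 := h.le_L_mul v
  have := h.L_pos
  nlinarith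

theorem isUnit_A_det (h : IsQuadNCSC A B C L μ μx) : IsUnit A.det := by
  rw [isUnit_iff_ne_zero]
  intro h0
  obtain ⟨v, hv, hv0⟩ := Matrix.exists_mulVec_eq_zero_iff.mpr h0
  have h1 := h.mu_mul_le v
  rw [hv0, dotProduct_zero] at h1
  have h2 : 0 < v ⬝ᵥ v := lt_of_le_of_ne (dotProduct_self_nonneg' v)
    (fun h' => hv (dotProduct_self_eq_zero.mp h'.symm))
  nlinarith [h.mu_pos]

/-- `A⁻¹ ≤ μ⁻¹`. -/
theorem quadForm_inv_le (h : IsQuadNCSC A B C L μ μx) (v : Fin m → ℝ) :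
    0 ≤ v ⬝ᵥ (A⁻¹ *ᵥ v) ∧ μ * (v ⬝ᵥ (A⁻¹ *ᵥ v)) ≤ v ⬝ᵥ v := by
  set w := A⁻¹ *ᵥ v with hw
  have hv : A *ᵥ w = v := by
    rw [hw, Matrix.mulVec_mulVec, Matrix.mul_nonsing_inv _ h.isUnit_A_det, Matrix.one_mulVec]
  have h1 := h.mu_mul_le w
  rw [hv, dotProduct_comm w v] at h1
  have h0 := dotProduct_self_nonneg' w
  have hμ := h.mu_pos
  -- Expanding `‖v - μw‖² ≥ 0` and using `μ‖w‖² ≤ v·w` turns the lower bound on `A` into an upper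
  -- bound on its inverse.
  have h2 := dotProduct_self_nonneg' (v - μ • w)
  simp only [dotProduct_sub, sub_dotProduct, dotProduct_smul, smul_dotProduct, smul_eq_mul,
    dotProduct_comm w v] at h2
  exact ⟨by nlinarith, by nlinarith⟩

theorem schur_le (h : IsQuadNCSC A B C L μ μx) (u : Fin n → ℝ) :
    μx * (u ⬝ᵥ u) ≤ u ⬝ᵥ (C *ᵥ u) + (Bᵀ *ᵥ u) ⬝ᵥ (A⁻¹ *ᵥ (Bᵀ *ᵥ u)) := by
  have := h.mux_le_schur.dotProduct_mulVec_nonneg u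
  simp [Matrix.sub_mulVec, Matrix.add_mulVec, dotProduct_sub, dotProduct_add,
    Matrix.smul_mulVec] at this
  rw [← Matrix.mulVec_mulVec, ← Matrix.mulVec_mulVec, ← dotProduct_mulVec_transpose B,
    dotProduct_comm (A⁻¹ *ᵥ _)] at this
  linarith

/-- Real eigenvalues of `M` are at most `-μ_x`. -/
theorem real_eigenvalue_le (h : IsQuadNCSC A B C L μ μx) {r α : ℝ} (hr : 2 * L ≤ r * μ)
    {u : Fin n → ℝ} {v : Fin m → ℝ} (h1 : -(C *ᵥ u) - B *ᵥ v = α • u)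
    (h2 : r • (Bᵀ *ᵥ u - A *ᵥ v) = α • v) (hne : u ≠ 0 ∨ v ≠ 0) : α ≤ -μx := by
  have hL := h.L_pos
  have hμ := h.mu_pos
  have hμx := h.mux_pos
  have hμxL := h.mux_le_L
  have hr0 : 0 < r := by by_contra hc; nlinarith
  by_contra! hα
  set s := α / r with hs
  have hαs : α = r * s := by rw [hs]; field_simp
  have hBu : Bᵀ *ᵥ u = A *ᵥ v + s • v := by
    have := congrArg (fun w => (1 / r) • w) h2
    simp only [smul_smul, one_div, inv_mul_cancel₀ hr0.ne', one_smul] at this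
    rw [sub_eq_iff_eq_add] at this
    rw [this, add_comm, hs, div_eq_inv_mul]
  have hU := dotProduct_self_nonneg' u
  have hV := dotProduct_self_nonneg' v
  have hUV : 0 < u ⬝ᵥ u ∨ 0 < v ⬝ᵥ v := by
    rcases hne with h' | h'
    · exact Or.inl (lt_of_le_of_ne hU fun h0 => h' (dotProduct_self_eq_zero.mp h0.symm))
    · exact Or.inr (lt_of_le_of_ne hV fun h0 => h' (dotProduct_self_eq_zero.mp h0.symm))
  have hc := (abs_le.mp (abs_quadForm_le h.norm_C_le u)).1
  have ha := h.mu_mul_le v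
  have hsch := h.schur_le u
  obtain ⟨hw0, hw⟩ := h.quadForm_inv_le v
  have e1 := congrArg (fun w => u ⬝ᵥ w) h1
  simp only [dotProduct_sub, dotProduct_neg, dotProduct_smul, smul_eq_mul] at e1
  have e2 : u ⬝ᵥ (B *ᵥ v) = v ⬝ᵥ (A *ᵥ v) + s * (v ⬝ᵥ v) := by
    rw [← dotProduct_mulVec_transpose, hBu, dotProduct_add, dotProduct_smul, smul_eq_mul]
  -- As `Bᵀu = (A + s)v`, the Schur term is the quadratic form of `(A + s) A⁻¹ (A + s) = A + 2s + s²
  -- A⁻¹` at `v`.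
  have e3 : (Bᵀ *ᵥ u) ⬝ᵥ (A⁻¹ *ᵥ (Bᵀ *ᵥ u))
      = v ⬝ᵥ (A *ᵥ v) + 2 * s * (v ⬝ᵥ v) + s ^ 2 * (v ⬝ᵥ (A⁻¹ *ᵥ v)) := by
    have hinv : A⁻¹ *ᵥ (A *ᵥ v) = v := by
      rw [Matrix.mulVec_mulVec, Matrix.nonsing_inv_mul _ h.isUnit_A_det, Matrix.one_mulVec]
    have hAinv : A *ᵥ (A⁻¹ *ᵥ v) = v := by
      rw [Matrix.mulVec_mulVec, Matrix.mul_nonsing_inv _ h.isUnit_A_det, Matrix.one_mulVec]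
    have h3 : (A *ᵥ v) ⬝ᵥ (A⁻¹ *ᵥ v) = v ⬝ᵥ v := by
      rw [dotProduct_comm, dotProduct_mulVec_symm h.symm_A, hAinv]
    rw [hBu, Matrix.mulVec_add, Matrix.mulVec_smul, hinv]
    simp only [add_dotProduct, dotProduct_add, dotProduct_smul, smul_dotProduct, smul_eq_mul, h3,
      dotProduct_comm (A *ᵥ v) v]
    ring
  rw [e3] at hsch
  rw [e2] at e1
  generalize u ⬝ᵥ u = U at *
  generalize v ⬝ᵥ v = V at *
  generalize u ⬝ᵥ (C *ᵥ u) = c at *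
  generalize v ⬝ᵥ (A *ᵥ v) = a at *
  generalize v ⬝ᵥ (A⁻¹ *ᵥ v) = w at *
  -- The form `c` is eliminated between the Schur bound and the tested first equation. The two sides
  -- of `key` are now compared, by the sign of `α`.
  have key : (α + μx) * U ≤ s * (V + s * w) := by nlinarith
  have key' : μ * ((α + μx) * U) ≤ μ * (s * (V + s * w)) := by gcongr
  rcases lt_or_ge α 0 with hneg | hpos
  · have hs0 : s < 0 := by rw [hs]; exact div_neg_of_neg_of_pos hneg hr0
    have hsμ : -μ ≤ 2 * s := by
      by_contra hc'
      nlinarith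
    have h5 : μ * V / 2 ≤ μ * (V + s * w) := by nlinarith
    have h6 : μ * (s * (V + s * w)) ≤ s * (μ * V / 2) := by nlinarith
    rcases hUV with h' | h'
    · have : 0 < μ * ((α + μx) * U) := mul_pos hμ (mul_pos (by linarith) h')
      have : s * (μ * V / 2) ≤ 0 := mul_nonpos_of_nonpos_of_nonneg hs0.le (by positivity)
      linarith
    · have : 0 ≤ μ * ((α + μx) * U) := mul_nonneg hμ.le (mul_nonneg (by linarith) hU)
      have : s * (μ * V / 2) < 0 := mul_neg_of_neg_of_pos hs0 (by positivity)
      linarith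
  -- Here the first equation and `‖C‖ ≤ L` bound `V` by `U`. Inserted in `key`, this gives `μ(α +
  -- μ_x) ≤ s(L - α)`, which is impossible since `μα = μrs ≥ 2Ls`.
  · have hs0 : 0 ≤ s := div_nonneg hpos hr0.le
    have h5 : (s + μ) * V ≤ (L - α) * U := by nlinarith
    have hUpos : 0 < U := by
      rcases hUV with h' | h'
      · exact h'
      · by_contra hc'
        have : U = 0 := le_antisymm (not_lt.mp hc') hU
        subst this
        have : 0 < (s + μ) * V := by positivity
        linarith
    have h6 : μ * (s * (V + s * w)) ≤ s * ((L - α) * U) := by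
      have : μ * (V + s * w) ≤ (s + μ) * V := by nlinarith
      nlinarith
    have h7 : μ * (α + μx) ≤ s * (L - α) := by
      have : (μ * (α + μx)) * U ≤ (s * (L - α)) * U := by linarith
      exact le_of_mul_le_mul_right this hUpos
    have h8 : 2 * L * s ≤ α * μ := by rw [hαs]; nlinarith
    have : 0 < μ * μx := mul_pos hμ hμx
    have : 0 ≤ s * α := mul_nonneg hs0 hpos
    nlinarith

end IsQuadNCSC

/-- `(u₁, v₁) + i (u₂, v₂)` is an eigenvector of `M` with eigenvalue `α + i β`, in real terms. -/
structure IsEigenPair {n m : ℕ} (A : Matrix (Fin m) (Fin m) ℝ) (B : Matrix (Fin n) (Fin m) ℝ)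
    (C : Matrix (Fin n) (Fin n) ℝ) (r α β : ℝ) (u₁ u₂ : Fin n → ℝ) (v₁ v₂ : Fin m → ℝ) :
    Prop where
  re_x : -(C *ᵥ u₁) - B *ᵥ v₁ = α • u₁ - β • u₂
  im_x : -(C *ᵥ u₂) - B *ᵥ v₂ = α • u₂ + β • u₁
  re_y : r • (Bᵀ *ᵥ u₁ - A *ᵥ v₁) = α • v₁ - β • v₂
  im_y : r • (Bᵀ *ᵥ u₂ - A *ᵥ v₂) = α • v₂ + β • v₁
  pos : 0 < u₁ ⬝ᵥ u₁ + u₂ ⬝ᵥ u₂ + (v₁ ⬝ᵥ v₁ + v₂ ⬝ᵥ v₂)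

theorem neg_sub_dotProduct_self_le {n : ℕ} (a b : Fin n → ℝ) :
    (-a - b) ⬝ᵥ (-a - b) ≤ 2 * (a ⬝ᵥ a) + 2 * (b ⬝ᵥ b) := by
  have := dotProduct_self_nonneg' (a - b)
  simp only [dotProduct_sub, sub_dotProduct, neg_dotProduct, dotProduct_neg] at *
  linarith [dotProduct_comm a b]

/-- The Cauchy-Schwarz inequality for `u₁ + i u₂` and `b₁ + i b₂`, in real terms. -/
theorem complex_cauchy_schwarz {n : ℕ} (u₁ u₂ b₁ b₂ : Fin n → ℝ) {K : ℝ} (hK : 0 < K)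
    (hb : b₁ ⬝ᵥ b₁ + b₂ ⬝ᵥ b₂ ≤ K) :
    (u₁ ⬝ᵥ b₁ + u₂ ⬝ᵥ b₂) ^ 2 + (u₁ ⬝ᵥ b₂ - u₂ ⬝ᵥ b₁) ^ 2
      ≤ K * (u₁ ⬝ᵥ u₁ + u₂ ⬝ᵥ u₂) := by
  have g : ∀ q t : ℝ, (K • u₁ - q • b₁ - t • b₂) ⬝ᵥ (K • u₁ - q • b₁ - t • b₂)
      + (K • u₂ - q • b₂ + t • b₁) ⬝ᵥ (K • u₂ - q • b₂ + t • b₁)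
      = K ^ 2 * (u₁ ⬝ᵥ u₁ + u₂ ⬝ᵥ u₂)
        - 2 * K * (q * (u₁ ⬝ᵥ b₁ + u₂ ⬝ᵥ b₂) + t * (u₁ ⬝ᵥ b₂ - u₂ ⬝ᵥ b₁))
        + (q ^ 2 + t ^ 2) * (b₁ ⬝ᵥ b₁ + b₂ ⬝ᵥ b₂) := by
    intro q t
    simp only [dotProduct_sub, sub_dotProduct, dotProduct_add, add_dotProduct, dotProduct_smul,
      smul_dotProduct, smul_eq_mul, dotProduct_comm b₁ u₁, dotProduct_comm b₁ u₂,
      dotProduct_comm b₂ u₁, dotProduct_comm b₂ u₂, dotProduct_comm b₂ b₁]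
    ring
  have h := g (u₁ ⬝ᵥ b₁ + u₂ ⬝ᵥ b₂) (u₁ ⬝ᵥ b₂ - u₂ ⬝ᵥ b₁)
  generalize u₁ ⬝ᵥ b₁ + u₂ ⬝ᵥ b₂ = q at *
  generalize u₁ ⬝ᵥ b₂ - u₂ ⬝ᵥ b₁ = t at *
  have h0 := add_nonneg (dotProduct_self_nonneg' (K • u₁ - q • b₁ - t • b₂))
    (dotProduct_self_nonneg' (K • u₂ - q • b₂ + t • b₁))
  rw [h] at h0
  have hN : (q ^ 2 + t ^ 2) * (b₁ ⬝ᵥ b₁ + b₂ ⬝ᵥ b₂) ≤ (q ^ 2 + t ^ 2) * K := by gcongr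
  refine le_of_mul_le_mul_left ?_ hK
  linarith

/-! ### Location of the eigenvalues of `M` -/

namespace IsEigenPair

variable {n m : ℕ} {A : Matrix (Fin m) (Fin m) ℝ} {B : Matrix (Fin n) (Fin m) ℝ}
  {C : Matrix (Fin n) (Fin n) ℝ} {L μ μx r α β : ℝ} {u₁ u₂ : Fin n → ℝ} {v₁ v₂ : Fin m → ℝ}

/-- This is the crude estimate `‖Mz‖² ≤ 2(1 + r²)L²‖z‖²`, with `‖a - b‖² ≤ 2‖a‖² + 2‖b‖²` in each
block, applied to an eigenvector. -/
theorem normSq_le (e : IsEigenPair A B C r α β u₁ u₂ v₁ v₂) (h : IsQuadNCSC A B C L μ μx) :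
    α ^ 2 + β ^ 2 ≤ 2 * (1 + r ^ 2) * L ^ 2 := by
  have key : ∀ {k : ℕ} (p q : Fin k → ℝ), (α • p - β • q) ⬝ᵥ (α • p - β • q)
      + (α • q + β • p) ⬝ᵥ (α • q + β • p) = (α ^ 2 + β ^ 2) * (p ⬝ᵥ p + q ⬝ᵥ q) := by
    intro k p q
    simp only [dotProduct_sub, sub_dotProduct, dotProduct_add, add_dotProduct, dotProduct_smul,
      smul_dotProduct, smul_eq_mul, dotProduct_comm q p]
    ring
  have kx := key u₁ u₂
  have ky := key v₁ v₂
  rw [← e.re_x, ← e.im_x] at kx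
  rw [← e.re_y, ← e.im_y] at ky
  simp only [smul_dotProduct, dotProduct_smul, smul_eq_mul] at ky
  have bx1 := neg_sub_dotProduct_self_le (C *ᵥ u₁) (B *ᵥ v₁)
  have bx2 := neg_sub_dotProduct_self_le (C *ᵥ u₂) (B *ᵥ v₂)
  have by1 := neg_sub_dotProduct_self_le (-(Bᵀ *ᵥ u₁)) (A *ᵥ v₁)
  have by2 := neg_sub_dotProduct_self_le (-(Bᵀ *ᵥ u₂)) (A *ᵥ v₂)
  simp only [neg_neg, neg_dotProduct, dotProduct_neg] at by1 by2
  have c1 := mulVec_dotProduct_mulVec_le h.norm_C_le u₁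
  have c2 := mulVec_dotProduct_mulVec_le h.norm_C_le u₂
  have b1 := mulVec_dotProduct_mulVec_le h.norm_B_le v₁
  have b2 := mulVec_dotProduct_mulVec_le h.norm_B_le v₂
  have t1 := transpose_mulVec_dotProduct_mulVec_le h.norm_B_le u₁
  have t2 := transpose_mulVec_dotProduct_mulVec_le h.norm_B_le u₂
  have a1 := h.mulVec_A_sq_le' v₁
  have a2 := h.mulVec_A_sq_le' v₂
  have hy : r ^ 2 * ((Bᵀ *ᵥ u₁ - A *ᵥ v₁) ⬝ᵥ (Bᵀ *ᵥ u₁ - A *ᵥ v₁)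
      + (Bᵀ *ᵥ u₂ - A *ᵥ v₂) ⬝ᵥ (Bᵀ *ᵥ u₂ - A *ᵥ v₂))
      ≤ r ^ 2 * (2 * L ^ 2 * (u₁ ⬝ᵥ u₁ + u₂ ⬝ᵥ u₂ + (v₁ ⬝ᵥ v₁ + v₂ ⬝ᵥ v₂))) := by
    gcongr
    linarith
  refine le_of_mul_le_mul_right ?_ e.pos
  linarith

/-- A non-real eigenvalue of `M` lies far to the left, in a disc touching the imaginary axis. -/
theorem nonreal_bounds (e : IsEigenPair A B C r α β u₁ u₂ v₁ v₂)
    (h : IsQuadNCSC A B C L μ μx) (hr : 2 * L ≤ r * μ) (hr2 : 2 ≤ r) (hβ : β ≠ 0) :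
    2 * α ≤ -L ∧ α ^ 2 + β ^ 2 ≤ 4 * r * L * (-α) := by
  have hL := h.L_pos
  have e1 := congrArg (fun w => u₁ ⬝ᵥ w) e.re_x
  have e2 := congrArg (fun w => u₂ ⬝ᵥ w) e.im_x
  have e3 := congrArg (fun w => u₁ ⬝ᵥ w) e.im_x
  have e4 := congrArg (fun w => u₂ ⬝ᵥ w) e.re_x
  have e5 := congrArg (fun w => v₁ ⬝ᵥ w) e.re_y
  have e6 := congrArg (fun w => v₂ ⬝ᵥ w) e.im_y
  have e7 := congrArg (fun w => v₁ ⬝ᵥ w) e.im_y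
  have e8 := congrArg (fun w => v₂ ⬝ᵥ w) e.re_y
  have hpos := e.pos
  have hnb1 := mulVec_dotProduct_mulVec_le h.norm_B_le v₁
  have hnb2 := mulVec_dotProduct_mulVec_le h.norm_B_le v₂
  have hc1 := abs_le.mp (abs_quadForm_le h.norm_C_le u₁)
  have hc2 := abs_le.mp (abs_quadForm_le h.norm_C_le u₂)
  have ha1 := h.mu_mul_le v₁
  have ha2 := h.mu_mul_le v₂
  simp only [dotProduct_sub, dotProduct_add, dotProduct_neg, dotProduct_smul, smul_eq_mul,
    dotProduct_mulVec_transpose] at e1 e2 e3 e4 e5 e6 e7 e8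
  rw [dotProduct_mulVec_symm h.symm_C u₂ u₁, dotProduct_comm u₂ u₁] at e4
  rw [dotProduct_comm u₂ u₁] at e2
  rw [dotProduct_mulVec_symm h.symm_A v₂ v₁, dotProduct_comm v₂ v₁] at e8
  rw [dotProduct_comm v₂ v₁] at e6
  set q := u₁ ⬝ᵥ (B *ᵥ v₁) + u₂ ⬝ᵥ (B *ᵥ v₂) with hq
  set t := u₁ ⬝ᵥ (B *ᵥ v₂) - u₂ ⬝ᵥ (B *ᵥ v₁) with ht
  set U := u₁ ⬝ᵥ u₁ + u₂ ⬝ᵥ u₂ with hU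
  set V := v₁ ⬝ᵥ v₁ + v₂ ⬝ᵥ v₂ with hV
  set c := u₁ ⬝ᵥ (C *ᵥ u₁) + u₂ ⬝ᵥ (C *ᵥ u₂) with hc
  set a := v₁ ⬝ᵥ (A *ᵥ v₁) + v₂ ⬝ᵥ (A *ᵥ v₂) with ha
  have f1 : α * U = -c - q := by linarith
  have f2 : β * U = -t := by linarith
  have f3 : α * V = r * (q - a) := by linarith
  have f4 : β * V = r * (-t) := by linarith
  -- The imaginary parts of the two tested equations read `βU = -t` and `βV = -rt`; this is where `β
  -- ≠ 0` is needed.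
  have hVU : V = r * U := mul_left_cancel₀ hβ (by rw [f4, ← f2]; ring)
  have hU0 : 0 < U := by
    rw [hVU] at hpos
    have : U + r * U = (1 + r) * U := by ring
    rw [this] at hpos
    exact pos_of_mul_pos_right hpos (by linarith)
  have f5 : α * U = q - a := by
    have : r * (α * U) = r * (q - a) := by rw [← f3, hVU]; ring
    exact mul_left_cancel₀ (by linarith) this
  have hCS : q ^ 2 + t ^ 2 ≤ L ^ 2 * V * U := by
    refine complex_cauchy_schwarz u₁ u₂ (B *ᵥ v₁) (B *ᵥ v₂) ?_ (by linarith)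
    rw [hVU]
    positivity
  have hcU : -(L * U) ≤ c ∧ c ≤ L * U := ⟨by rw [hc, hU]; linarith, by rw [hc, hU]; linarith⟩
  have haU : 2 * L * U ≤ a := by
    have : μ * V ≤ a := by rw [ha, hV]; linarith
    calc 2 * L * U ≤ r * μ * U := by gcongr
      _ = μ * V := by rw [hVU]; ring
      _ ≤ a := this
  clear_value q t U V c a
  clear hnb1 hnb2 hc1 hc2 ha1 ha2 e1 e2 e3 e4 e5 e6 e7 e8 hpos
  have f6 : 2 * (α * U) = -c - a := by linarith
  constructor
  · refine le_of_mul_le_mul_right ?_ hU0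
    nlinarith
  · have hq2 : 2 * q = a - c := by linarith
    -- The relation `2q = a - c`, obtained by equating the two expressions for `αU`, turns `(c + q)²
    -- + t²` into `q² + t² + ca`, where the Cauchy-Schwarz bound applies.
    have hn : (α ^ 2 + β ^ 2) * U ^ 2 = q ^ 2 + t ^ 2 + c * a := by
      have : (α ^ 2 + β ^ 2) * U ^ 2 = (-c - q) ^ 2 + (-t) ^ 2 := by rw [← f1, ← f2]; ring
      rw [this]
      linear_combination c * hq2
    have hca : c * a ≤ L * U * a := by
      have : 0 ≤ a := le_trans (by positivity) haU
      nlinarith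
    rw [hVU] at hCS
    have hfin : (α ^ 2 + β ^ 2) * U ^ 2 ≤ (4 * r * L * (-α)) * U ^ 2 := by
      have h1 : (4 * r * L * (-α)) * U ^ 2 = 2 * r * L * U * (c + a) := by
        linear_combination (-2 * r * L * U) * f6
      have h2 : r * (2 * L * U) ≤ r * a := by gcongr
      have h3 : 2 * a ≤ r * a := by
        have : 0 ≤ a := le_trans (by positivity) haU
        gcongr
      have h4 : r * L * U + a ≤ 2 * r * (a - L * U) := by linarith
      have h5 : (L * U) * (r * L * U + a) ≤ (L * U) * (2 * r * (a - L * U)) := by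
        have := hL.le
        gcongr
      have h6 : 2 * r * L * U * (a - L * U) ≤ 2 * r * L * U * (c + a) := by
        gcongr
        linarith
      rw [hn, h1]
      linarith
    exact le_of_mul_le_mul_right hfin (by positivity)

/-- For real eigenvalues the disc condition follows from `|α| ≤ (8/5) r L`. The constant `8/5` comes
from `2(1 + r²) ≤ (64/25) r²`, valid for `r ≥ 2`; after scaling by `1/(4rL)` it becomes `2/5`. -/
theorem eigenvalue_bounds (e : IsEigenPair A B C r α β u₁ u₂ v₁ v₂)
    (h : IsQuadNCSC A B C L μ μx) (hr : 2 * L ≤ r * μ) (hr2 : 2 ≤ r) :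
    2 * α ≤ -μx ∧ α ^ 2 + β ^ 2 ≤ 4 * r * L * (-α) ∧ α ^ 2 + β ^ 2 ≤ (8 / 5 * r * L) ^ 2 := by
  have hL := h.L_pos
  have hn : α ^ 2 + β ^ 2 ≤ (8 / 5 * r * L) ^ 2 := by
    refine (e.normSq_le h).trans ?_
    have : 2 * (1 + r ^ 2) ≤ (8 / 5 * r) ^ 2 := by nlinarith
    calc _ ≤ (8 / 5 * r) ^ 2 * L ^ 2 := by gcongr
      _ = _ := by ring
  by_cases hβ : β = 0
  · subst hβ
    have hα : α ≤ -μx := by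
      by_cases h1 : u₁ ≠ 0 ∨ v₁ ≠ 0
      · exact h.real_eigenvalue_le hr (by simpa using e.re_x) (by simpa using e.re_y) h1
      · push Not at h1
        obtain ⟨rfl, rfl⟩ := h1
        refine h.real_eigenvalue_le hr (u := u₂) (v := v₂) (by simpa using e.im_x)
          (by simpa using e.im_y) ?_
        by_contra! h2
        obtain ⟨rfl, rfl⟩ := h2
        simpa using e.pos
    have hμx := h.mux_pos
    have hα2 : -α ≤ 8 / 5 * r * L := by
      have : 0 ≤ 8 / 5 * r * L := by positivity
      nlinarith
    refine ⟨by linarith, ?_, hn⟩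
    have : (-α) * (-α) ≤ (8 / 5 * r * L) * (-α) := by
      gcongr
      linarith
    have : 0 ≤ r * L * (-α) := mul_nonneg (by positivity) (by linarith)
    nlinarith
  · obtain ⟨h1, h2⟩ := e.nonreal_bounds h hr hr2 hβ
    exact ⟨by linarith [h.mux_le_L], h2, hn⟩

end IsEigenPair

/-! ### Eigenvectors from the Jordan form, and contraction of the steps in Jordan coordinates -/

section Jordan

variable {n m : ℕ}

/-- The matrix `M`, over `ℂ` and with the coordinates numbered in the usual order. -/
def complexMat (M : Matrix (Fin n ⊕ Fin m) (Fin n ⊕ Fin m) ℝ) :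
    Matrix (Fin (n + m)) (Fin (n + m)) ℂ :=
  (Matrix.reindex finSumFinEquiv finSumFinEquiv M).map (fun t : ℝ => (t : ℂ))

theorem complexMat_mulVec (M : Matrix (Fin n ⊕ Fin m) (Fin n ⊕ Fin m) ℝ)
    (w : Fin (n + m) → ℂ) (k : Fin n ⊕ Fin m) :
    (complexMat M *ᵥ w) (finSumFinEquiv k) = ∑ l, (M k l : ℂ) * w (finSumFinEquiv l) := by
  rw [Matrix.mulVec, dotProduct, ← finSumFinEquiv.sum_comp]
  simp [complexMat]

theorem det_diag_sub_eq_zero {N : ℕ} {J : Matrix (Fin N) (Fin N) ℂ} {δ : ℝ}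
    (hJ : IsJordanForm J δ) (i : Fin N) : (J i i • (1 : Matrix (Fin N) (Fin N) ℂ) - J).det = 0 := by
  rw [Matrix.det_of_isUpperTriangular]
  · exact Finset.prod_eq_zero (Finset.mem_univ i) (by simp)
  · intro k l hkl
    have hlt : l < k := hkl
    have h0 : J k l = 0 := hJ.off_eq_zero k l (by have := Fin.lt_def.mp hlt; omega)
      (by have := Fin.lt_def.mp hlt; omega)
    simp [h0, Matrix.one_apply_ne hlt.ne']

theorem exists_eigenvector {M : Matrix (Fin n ⊕ Fin m) (Fin n ⊕ Fin m) ℝ}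
    {P J : Matrix (Fin (n + m)) (Fin (n + m)) ℂ} {δ : ℝ} (h : IsJordanDecomp M P J δ)
    (i : Fin (n + m)) : ∃ w ≠ 0, complexMat M *ᵥ w = J i i • w := by
  obtain ⟨hP, hJ, hM⟩ := h
  have hdet : (J i i • (1 : Matrix (Fin (n + m)) (Fin (n + m)) ℂ) - complexMat M).det = 0 := by
    have : J i i • (1 : Matrix (Fin (n + m)) (Fin (n + m)) ℂ) - complexMat M
        = P⁻¹ * (J i i • (1 : Matrix (Fin (n + m)) (Fin (n + m)) ℂ) - J) * P := by
      rw [complexMat, hM]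
      simp [Matrix.mul_sub, Matrix.sub_mul, Matrix.nonsing_inv_mul _ hP]
    rw [this, Matrix.det_mul, Matrix.det_mul, det_diag_sub_eq_zero hJ]
    simp
  obtain ⟨w, hw, hw0⟩ := Matrix.exists_mulVec_eq_zero_iff.mpr hdet
  refine ⟨w, hw, ?_⟩
  rw [Matrix.sub_mulVec, sub_eq_zero, Matrix.smul_mulVec, Matrix.one_mulVec] at hw0
  exact hw0.symm

theorem exists_eigenPair {A : Matrix (Fin m) (Fin m) ℝ} {B : Matrix (Fin n) (Fin m) ℝ}
    {C : Matrix (Fin n) (Fin n) ℝ} {r : ℝ} {P J : Matrix (Fin (n + m)) (Fin (n + m)) ℂ} {δ : ℝ}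
    (h : IsJordanDecomp (matM A B C r) P J δ) (i : Fin (n + m)) :
    ∃ u₁ u₂ v₁ v₂, IsEigenPair A B C r (J i i).re (J i i).im u₁ u₂ v₁ v₂ := by
  obtain ⟨w, hw, hMw⟩ := exists_eigenvector h i
  have hk : ∀ k, ∑ l, (matM A B C r k l : ℂ) * w (finSumFinEquiv l)
      = J i i * w (finSumFinEquiv k) := by
    intro k
    rw [← complexMat_mulVec, hMw]
    simp
  have hre : matM A B C r *ᵥ (fun l => (w (finSumFinEquiv l)).re)
      = (J i i).re • (fun l => (w (finSumFinEquiv l)).re)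
        - (J i i).im • (fun l => (w (finSumFinEquiv l)).im) := by
    ext k
    have := congrArg Complex.re (hk k)
    simpa [Matrix.mulVec, dotProduct] using this
  have him : matM A B C r *ᵥ (fun l => (w (finSumFinEquiv l)).im)
      = (J i i).re • (fun l => (w (finSumFinEquiv l)).im)
        + (J i i).im • (fun l => (w (finSumFinEquiv l)).re) := by
    ext k
    have := congrArg Complex.im (hk k)
    simpa [Matrix.mulVec, dotProduct] using this
  rw [matM, Matrix.fromBlocks_mulVec] at hre him
  refine ⟨fun l => (w (finSumFinEquiv (Sum.inl l))).re, fun l => (w (finSumFinEquiv (Sum.inl l))).im,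
    fun l => (w (finSumFinEquiv (Sum.inr l))).re, fun l => (w (finSumFinEquiv (Sum.inr l))).im,
    ?_, ?_, ?_, ?_, ?_⟩
  · ext k
    have := congrFun hre (Sum.inl k)
    simpa [Matrix.neg_mulVec, sub_eq_add_neg, Function.comp_def] using this
  · ext k
    have := congrFun him (Sum.inl k)
    simpa [Matrix.neg_mulVec, sub_eq_add_neg, Function.comp_def] using this
  · ext k
    have := congrFun hre (Sum.inr k)
    simpa [Matrix.neg_mulVec, Matrix.smul_mulVec, mul_add, sub_eq_add_neg, Function.comp_def]
      using this
  · ext k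
    have := congrFun him (Sum.inr k)
    simpa [Matrix.neg_mulVec, Matrix.smul_mulVec, mul_add, sub_eq_add_neg, Function.comp_def]
      using this
  · obtain ⟨k, hk0⟩ := Function.ne_iff.mp hw
    have hsum : 0 < ∑ k, Complex.normSq (w k) :=
      Finset.sum_pos' (fun _ _ => Complex.normSq_nonneg _)
        ⟨k, Finset.mem_univ k, Complex.normSq_pos.mpr hk0⟩
    rw [← finSumFinEquiv.sum_comp] at hsum
    simp only [Complex.normSq_apply, Fintype.sum_sum_type, Finset.sum_add_distrib] at hsum
    simp only [dotProduct]
    linarith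

/-- The part of a matrix on the first superdiagonal. -/
def superdiag {N : ℕ} (J : Matrix (Fin N) (Fin N) ℂ) : Matrix (Fin N) (Fin N) ℂ :=
  Matrix.of fun i j => if (j : ℕ) = i + 1 then J i j else 0

theorem IsJordanForm.eq_add {N : ℕ} {J : Matrix (Fin N) (Fin N) ℂ} {δ : ℝ}
    (hJ : IsJordanForm J δ) : J = Matrix.diagonal (fun i => J i i) + superdiag J := by
  ext i j
  by_cases h1 : i = j
  · subst h1
    simp [superdiag]
  · have h1' : (j : ℕ) ≠ i := fun h => h1 (Fin.ext h.symm)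
    by_cases h2 : (j : ℕ) = i + 1
    · simp [superdiag, h1, h2]
    · simp [superdiag, h1, h2, hJ.off_eq_zero i j h1' h2]

/-- For `R = superdiag J`, each row and each column has at most one nonzero entry, so `RᴴR` is
diagonal with entries at most `δ²`, and `‖R‖² = ‖RᴴR‖`. -/
theorem IsJordanForm.norm_superdiag_le {N : ℕ} {J : Matrix (Fin N) (Fin N) ℂ} {δ : ℝ}
    (hJ : IsJordanForm J δ) (hδ : 0 ≤ δ) : ‖superdiag J‖ ≤ δ := by
  have hentry : ∀ i j, ‖superdiag J i j‖ ≤ δ := by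
    intro i j
    simp only [superdiag, Matrix.of_apply]
    split_ifs with h
    · rcases hJ.super i j h with h' | h'
      · simpa [h'] using hδ
      · simp [h'.1, abs_of_nonneg hδ]
    · simpa using hδ
  have hdiag : (superdiag J)ᴴ * superdiag J
      = Matrix.diagonal fun j => ((superdiag J)ᴴ * superdiag J) j j := by
    ext j k
    by_cases hjk : j = k
    · subst hjk
      simp
    · rw [Matrix.diagonal_apply_ne _ hjk, Matrix.mul_apply]
      refine Finset.sum_eq_zero fun i _ => ?_
      simp only [superdiag, Matrix.conjTranspose_apply, Matrix.of_apply]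
      split_ifs with h1 h2 <;> simp
      exact absurd (Fin.ext (by omega)) hjk
  have hsq : ‖superdiag J‖ * ‖superdiag J‖ ≤ δ * δ := by
    rw [← Matrix.l2_opNorm_conjTranspose_mul_self, hdiag, Matrix.l2_opNorm_diagonal]
    refine (pi_norm_le_iff_of_nonneg (by positivity)).mpr fun j => ?_
    rw [Matrix.mul_apply]
    by_cases hj : ∃ i : Fin N, (j : ℕ) = i + 1
    · obtain ⟨i, hi⟩ := hj
      rw [Finset.sum_eq_single i]
      · rw [norm_mul, Matrix.conjTranspose_apply, norm_star]
        have := hentry i j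
        gcongr
      · intro k _ hk
        have : (j : ℕ) ≠ k + 1 := fun h => hk (Fin.ext (by omega))
        simp [superdiag, this]
      · simp
    · push Not at hj
      rw [Finset.sum_eq_zero]
      · simpa using mul_nonneg hδ hδ
      · intro k _
        simp [superdiag, hj k]
  exact abs_le_of_sq_le_sq' (by nlinarith) hδ |>.2

/-- Conditions on the spectrum of the (scaled) generator under which the steps of GDA and EG
are contractions at rate `x`. -/
structure StableAt (w : ℂ) (x : ℝ) : Prop where
  re_le : w.re ≤ -(x / 8)
  normSq_le : w.re ^ 2 + w.im ^ 2 ≤ -w.re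
  norm_le : w.re ^ 2 + w.im ^ 2 ≤ (2 / 5) ^ 2

theorem StableAt.norm_le' {w : ℂ} {x : ℝ} (h : StableAt w x) : ‖w‖ ≤ 2 / 5 := by
  refine abs_le_of_sq_le_sq' ?_ (by norm_num) |>.2
  rw [Complex.sq_norm, Complex.normSq_apply]
  linarith [h.norm_le]

/-- `|1 + w|² = 1 + 2 Re w + |w|² ≤ 1 + Re w ≤ 1 - x/8 ≤ (1 - x/16)²`. -/
theorem StableAt.norm_one_add_le {w : ℂ} {x : ℝ} (h : StableAt w x) (hx : x ≤ 1) :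
    ‖1 + w‖ ≤ 1 - x / 16 := by
  refine abs_le_of_sq_le_sq' ?_ (by linarith) |>.2
  rw [Complex.sq_norm, Complex.normSq_apply]
  have := h.re_le
  have := h.normSq_le
  simp only [Complex.add_re, Complex.one_re, Complex.add_im, Complex.one_im]
  nlinarith

/-- With `t = -Re w` and `N = |w|²`, the square is `1 - 2t + 4t² - N - 2tN + N²`. The bounds `t² ≤
N`, `t ≤ 2/5` and `N² ≤ (4/25)t` leave at most `1 - (16/25)t ≤ 1 - (2/25)x`. -/
theorem StableAt.norm_one_add_add_sq_le {w : ℂ} {x : ℝ} (h : StableAt w x) (hx : x ≤ 1) :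
    ‖1 + w + w ^ 2‖ ≤ 1 - x / 25 := by
  refine abs_le_of_sq_le_sq' ?_ (by linarith) |>.2
  rw [Complex.sq_norm, Complex.normSq_apply]
  obtain ⟨h1, h2, h3⟩ := h
  simp only [Complex.add_re, Complex.one_re, Complex.add_im, Complex.one_im, pow_two,
    Complex.mul_re, Complex.mul_im]
  obtain ⟨a, b⟩ := w
  simp only at *
  obtain ⟨t, rfl⟩ : ∃ t, a = -t := ⟨-a, by ring⟩
  have ht0 : 0 ≤ t := by nlinarith
  have ht : t ≤ 2 / 5 := by nlinarith
  have hid : (1 + -t + (-t * -t - b * b)) * (1 + -t + (-t * -t - b * b))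
      + (0 + b + (-t * b + b * -t)) * (0 + b + (-t * b + b * -t))
      = 1 - 2 * t + 4 * t ^ 2 - ((-t) ^ 2 + b ^ 2) - 2 * t * ((-t) ^ 2 + b ^ 2)
        + ((-t) ^ 2 + b ^ 2) ^ 2 := by ring
  rw [hid]
  have hN : t ^ 2 ≤ (-t) ^ 2 + b ^ 2 := by nlinarith
  generalize (-t) ^ 2 + b ^ 2 = N at *
  have h5 : N ^ 2 ≤ 4 / 25 * t := by nlinarith
  have h6 : 3 * t ^ 2 ≤ 6 / 5 * t := by nlinarith
  have h7 : 0 ≤ 2 * t * N := by have : 0 ≤ N := le_trans (sq_nonneg t) hN; positivity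
  nlinarith [sq_nonneg x]

/-! ### Norms of the step matrices: diagonal part plus a small perturbation -/

section JordanNorm

variable {N : ℕ} {J : Matrix (Fin N) (Fin N) ℂ} {δ η x : ℝ}

theorem IsJordanForm.smul_eq_add (hJ : IsJordanForm J δ) :
    (η : ℂ) • J = Matrix.diagonal (fun i => (η : ℂ) * J i i) + (η : ℂ) • superdiag J := by
  conv_lhs => rw [hJ.eq_add, smul_add]
  congr 1
  ext i j
  by_cases h : i = j <;> simp [h, Matrix.diagonal]

theorem norm_smul_superdiag_le (hJ : IsJordanForm J δ) (hδ : 0 ≤ δ) (hη : 0 ≤ η)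
    (hηδ : η * δ ≤ x / 256) : ‖(η : ℂ) • superdiag J‖ ≤ x / 256 := by
  rw [norm_smul, Complex.norm_real, Real.norm_of_nonneg hη]
  exact (by gcongr; exact hJ.norm_superdiag_le hδ : _ ≤ η * δ).trans hηδ

theorem norm_diagonal_le {v : Fin N → ℂ} {a : ℝ} (ha : 0 ≤ a) (h : ∀ i, ‖v i‖ ≤ a) :
    ‖Matrix.diagonal v‖ ≤ a := by
  rw [Matrix.l2_opNorm_diagonal]
  exact (pi_norm_le_iff_of_nonneg ha).mpr h

theorem norm_smul_jordan_le (hJ : IsJordanForm J δ) (hδ : 0 ≤ δ) (hη : 0 ≤ η) (hx : x ≤ 1)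
    (hηδ : η * δ ≤ x / 256) (hst : ∀ i, StableAt ((η : ℂ) * J i i) x) :
    ‖(η : ℂ) • J‖ ≤ 1 / 2 := by
  rw [hJ.smul_eq_add]
  refine (norm_add_le _ _).trans ?_
  have h1 := norm_diagonal_le (by norm_num) fun i => (hst i).norm_le'
  have h2 := norm_smul_superdiag_le hJ hδ hη hηδ
  linarith

theorem norm_one_add_jordan_le (hJ : IsJordanForm J δ) (hδ : 0 ≤ δ) (hη : 0 ≤ η) (hx0 : 0 ≤ x)
    (hx : x ≤ 1)
    (hηδ : η * δ ≤ x / 256) (hst : ∀ i, StableAt ((η : ℂ) * J i i) x) :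
    ‖1 + (η : ℂ) • J‖ ≤ 1 - x / 40 := by
  have h0 : 1 + (η : ℂ) • J
      = Matrix.diagonal (fun i => 1 + (η : ℂ) * J i i) + (η : ℂ) • superdiag J := by
    rw [hJ.smul_eq_add, ← add_assoc, ← Matrix.diagonal_one, Matrix.diagonal_add]
  rw [h0]
  refine (norm_add_le _ _).trans ?_
  have h1 := norm_diagonal_le (by linarith) fun i => (hst i).norm_one_add_le hx
  have h2 := norm_smul_superdiag_le hJ hδ hη hηδ
  linarith

theorem norm_one_add_add_sq_jordan_le (hJ : IsJordanForm J δ) (hδ : 0 ≤ δ) (hη : 0 ≤ η)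
    (hx0 : 0 ≤ x) (hx : x ≤ 1)
    (hηδ : η * δ ≤ x / 256) (hst : ∀ i, StableAt ((η : ℂ) * J i i) x) :
    ‖1 + (η : ℂ) • J + ((η : ℂ) • J) * ((η : ℂ) • J)‖ ≤ 1 - x / 40 := by
  have h1 := norm_diagonal_le (by norm_num) fun i => (hst i).norm_le'
  have h2 := norm_smul_superdiag_le hJ hδ hη hηδ
  have h3 := norm_diagonal_le (by linarith) fun i => (hst i).norm_one_add_add_sq_le hx
  rw [hJ.smul_eq_add]
  set D := Matrix.diagonal fun i => (η : ℂ) * J i i with hD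
  set R := (η : ℂ) • superdiag J
  have h0 : 1 + (D + R) + (D + R) * (D + R)
      = Matrix.diagonal (fun i => 1 + (η : ℂ) * J i i + ((η : ℂ) * J i i) ^ 2)
        + (R + (D * R + R * D + R * R)) := by
    have : Matrix.diagonal (fun i => 1 + (η : ℂ) * J i i + ((η : ℂ) * J i i) ^ 2)
        = 1 + D + D * D := by
      rw [hD, Matrix.diagonal_mul_diagonal, ← Matrix.diagonal_one, Matrix.diagonal_add,
        Matrix.diagonal_add]
      simp [pow_two]
    rw [this]
    noncomm_ring
  rw [h0]
  -- The perturbation totals less than `2x/256`, which fits in the gap between `x/25` and `x/40`.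
  have hDR : ‖D * R‖ ≤ 2 / 5 * (x / 256) := (norm_mul_le _ _).trans (by gcongr)
  have hRD : ‖R * D‖ ≤ x / 256 * (2 / 5) := (norm_mul_le _ _).trans (by gcongr)
  have hRR : ‖R * R‖ ≤ x / 256 * (1 / 256) := (norm_mul_le _ _).trans (by gcongr; linarith)
  calc _ ≤ ‖Matrix.diagonal (fun i => 1 + (η : ℂ) * J i i + ((η : ℂ) * J i i) ^ 2)‖
        + (‖R‖ + (‖D * R‖ + ‖R * D‖ + ‖R * R‖)) := by
        refine (norm_add_le _ _).trans ?_
        gcongr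
        refine (norm_add_le _ _).trans ?_
        gcongr
        refine (norm_add_le _ _).trans ?_
        gcongr
        exact norm_add_le _ _
    _ ≤ _ := by linarith

end JordanNorm

/-- The diagonal of `J` is stable, with the rate `1 / (r κ_x)` of the theorem. -/
theorem IsQuadNCSC.stableAt {A : Matrix (Fin m) (Fin m) ℝ} {B : Matrix (Fin n) (Fin m) ℝ}
    {C : Matrix (Fin n) (Fin n) ℝ} {L μ μx r : ℝ} {P J : Matrix (Fin (n + m)) (Fin (n + m)) ℂ}
    {δ : ℝ} (h : IsQuadNCSC A B C L μ μx) (hr : 2 * L ≤ r * μ) (hr2 : 2 ≤ r)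
    (hd : IsJordanDecomp (matM A B C r) P J δ) (i : Fin (n + m)) :
    StableAt (((1 / (4 * r * L) : ℝ) : ℂ) * J i i) (1 / (r * (L / μx))) := by
  obtain ⟨u₁, u₂, v₁, v₂, e⟩ := exists_eigenPair hd i
  obtain ⟨h1, h2, h3⟩ := e.eigenvalue_bounds h hr hr2
  have hL := h.L_pos
  have hμx := h.mux_pos
  have hr0 : 0 < r := by linarith
  constructor
  · rw [Complex.re_ofReal_mul]
    calc 1 / (4 * r * L) * (J i i).re ≤ 1 / (4 * r * L) * (-(μx / 2)) := by
          gcongr; linarith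
      _ = _ := by field_simp; ring
  · rw [Complex.re_ofReal_mul, Complex.im_ofReal_mul]
    calc _ = (1 / (4 * r * L)) ^ 2 * ((J i i).re ^ 2 + (J i i).im ^ 2) := by ring
      _ ≤ (1 / (4 * r * L)) ^ 2 * (4 * r * L * (-(J i i).re)) := by gcongr
      _ = _ := by field_simp
  · rw [Complex.re_ofReal_mul, Complex.im_ofReal_mul]
    calc _ = (1 / (4 * r * L)) ^ 2 * ((J i i).re ^ 2 + (J i i).im ^ 2) := by ring
      _ ≤ (1 / (4 * r * L)) ^ 2 * (8 / 5 * r * L) ^ 2 := by gcongr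
      _ = _ := by field_simp; norm_num

end Jordan

/-! ### Linear iterations driven by uncorrelated noise -/

section Stochastic

variable {Ω : Type u} [MeasurableSpace Ω] {ν : Measure Ω}
  {E F : Type*} [NormedAddCommGroup E] [NormedSpace ℝ E]
  [NormedAddCommGroup F] [InnerProductSpace ℝ F]

theorem integrable_bilin_of_memLp {X Y : Ω → E} (hX : MemLp X 2 ν) (hY : MemLp Y 2 ν)
    (β : E →L[ℝ] E →L[ℝ] ℝ) : Integrable (fun ω => β (X ω) (Y ω)) ν := by
  have h1 : Integrable (fun ω => ‖β‖ * (‖X ω‖ * ‖Y ω‖)) ν :=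
    (hX.norm.integrable_mul hY.norm).const_mul _
  refine h1.mono' ?_ (Filter.Eventually.of_forall fun ω => ?_)
  · exact Continuous.comp_aestronglyMeasurable₂ (g := (β · ·)) (by fun_prop) hX.1 hY.1
  · rw [← mul_assoc]
    exact β.le_opNorm₂ _ _

/-- `X` and `Y` are uncorrelated: every bilinear form of them has mean zero. -/
def Uncorrelated (ν : Measure Ω) (X Y : Ω → E) : Prop :=
  ∀ β : E →L[ℝ] E →L[ℝ] ℝ, ∫ ω, β (X ω) (Y ω) ∂ν = 0

/-- This is the only use of independence. Unlike independence, being uncorrelated passes to sums as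
well as to linear images, which is what the iterates require. -/
theorem uncorrelated_of_indepFun [CompleteSpace E] [MeasurableSpace E] [BorelSpace E]
    {X Y : Ω → E} (h : IndepFun X Y ν) (hX : Integrable X ν) (hY : Integrable Y ν)
    (h0 : ∫ ω, X ω ∂ν = 0) : Uncorrelated ν X Y := by
  intro β
  rw [h.integral_bilin hX hY β, h0]
  simp

theorem Uncorrelated.comp {X Y : Ω → E} (h : Uncorrelated ν X Y) (K₁ K₂ : E →L[ℝ] E) :
    Uncorrelated ν (fun ω => K₁ (X ω)) (fun ω => K₂ (Y ω)) := fun β =>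
  h (β.bilinearComp K₁ K₂)

theorem Uncorrelated.add_left {X X' Y : Ω → E} (h : Uncorrelated ν X Y)
    (h' : Uncorrelated ν X' Y) (hX : MemLp X 2 ν) (hX' : MemLp X' 2 ν) (hY : MemLp Y 2 ν) :
    Uncorrelated ν (fun ω => X ω + X' ω) Y := by
  intro β
  simp only [map_add, add_apply]
  rw [integral_add (integrable_bilin_of_memLp hX hY β) (integrable_bilin_of_memLp hX' hY β),
    h β, h' β, add_zero]

theorem Uncorrelated.add_right {X Y Y' : Ω → E} (h : Uncorrelated ν X Y)
    (h' : Uncorrelated ν X Y') (hX : MemLp X 2 ν) (hY : MemLp Y 2 ν) (hY' : MemLp Y' 2 ν) :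
    Uncorrelated ν X (fun ω => Y ω + Y' ω) := by
  intro β
  simp only [map_add]
  rw [integral_add (integrable_bilin_of_memLp hX hY β) (integrable_bilin_of_memLp hX hY' β),
    h β, h' β, add_zero]

theorem uncorrelated_const [IsProbabilityMeasure ν] [CompleteSpace E] {Y : Ω → E} (x : E)
    (hY : MemLp Y 2 ν) (h0 : ∫ ω, Y ω ∂ν = 0) : Uncorrelated ν (fun _ => x) Y := by
  intro β
  rw [(β x).integral_comp_comm (hY.integrable (by norm_num)), h0, map_zero]

/-- A linear iteration `z_{k+1} = G z_k + w_k` with uncorrelated centred noise, where `G` is a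
contraction with factor `ρ` in the norm `‖Q ·‖`. -/
theorem linear_iteration_bound [IsProbabilityMeasure ν] [CompleteSpace E] {G : E →L[ℝ] E}
    {Q : E →L[ℝ] F} {z w : ℕ → Ω → E} {z₀ : E} {ρ τ : ℝ}
    (hz0 : ∀ ω, z 0 ω = z₀) (hz : ∀ k ω, z (k + 1) ω = G (z k ω) + w k ω)
    (hw : ∀ k, MemLp (w k) 2 ν) (hmean : ∀ k, ∫ ω, w k ω ∂ν = 0)
    (hunc : ∀ j k, j ≠ k → Uncorrelated ν (w j) (w k))
    (hρ0 : 0 ≤ ρ) (hρ : ρ < 1) (hG : ∀ v, ‖Q (G v)‖ ≤ ρ * ‖Q v‖)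
    (hτ : ∀ k, ∫ ω, ‖Q (w k ω)‖ ^ 2 ∂ν ≤ τ) (T : ℕ) :
    MemLp (z T) 2 ν ∧ ∫ ω, ‖Q (z T ω)‖ ^ 2 ∂ν ≤ ρ ^ (2 * T) * ‖Q z₀‖ ^ 2 + τ / (1 - ρ) := by
  have hstep : ∀ k, z (k + 1) = fun ω => G (z k ω) + w k ω := fun k => funext (hz k)
  have hmem : ∀ k, MemLp (z k) 2 ν := by
    intro k
    induction k with
    | zero =>
      rw [show z 0 = fun _ => z₀ from funext hz0]
      exact memLp_const _
    | succ k ih =>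
      rw [hstep]
      exact (G.comp_memLp' ih).add (hw k)
  -- The iterate `z k` involves only the noises with index below `k`.
  have hzw : ∀ k j, k ≤ j → Uncorrelated ν (z k) (w j) := by
    intro k
    induction k with
    | zero =>
      intro j _
      rw [show z 0 = fun _ => z₀ from funext hz0]
      exact uncorrelated_const z₀ (hw j) (hmean j)
    | succ k ih =>
      intro j hj
      rw [hstep]
      exact ((ih j (by omega)).comp G (ContinuousLinearMap.id ℝ E)).add_left
        (hunc k j (by omega)) (G.comp_memLp' (hmem k)) (hw k) (hw j)
  have hτ0 : 0 ≤ τ := (integral_nonneg fun ω => by positivity).trans (hτ 0)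
  refine ⟨hmem T, ?_⟩
  induction T with
  | zero =>
    simp only [hz0, integral_const, probReal_univ, one_smul, mul_zero, pow_zero, one_mul]
    have : 0 ≤ τ / (1 - ρ) := div_nonneg hτ0 (by linarith)
    linarith
  | succ k ih =>
    have hint : ∀ {X : Ω → E}, MemLp X 2 ν → Integrable (fun ω => ‖Q (X ω)‖ ^ 2) ν :=
      fun hX => (Q.comp_memLp' hX).integrable_norm_pow (by norm_num)
    set β : E →L[ℝ] E →L[ℝ] ℝ :=
      ((isBoundedBilinearMap_inner (𝕜 := ℝ) (E := F)).toContinuousLinearMap).bilinearComp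
        (Q.comp G) Q with hβ
    have hβ' : ∀ x y, β x y = inner ℝ (Q (G x)) (Q y) := fun x y => rfl
    have hexp : ∀ ω, ‖Q (z (k + 1) ω)‖ ^ 2
        = ‖Q (G (z k ω))‖ ^ 2 + 2 * β (z k ω) (w k ω) + ‖Q (w k ω)‖ ^ 2 := by
      intro ω
      rw [hz, map_add, norm_add_sq_real, hβ']
    have hi1 : Integrable (fun ω => ‖Q (G (z k ω))‖ ^ 2) ν := hint (G.comp_memLp' (hmem k))
    have hi2 := (integrable_bilin_of_memLp (hmem k) (hw k) β).const_mul 2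
    have hi3 := hint (hw k)
    have hi12 : Integrable (fun ω => ‖Q (G (z k ω))‖ ^ 2 + 2 * β (z k ω) (w k ω)) ν :=
      hi1.add hi2
    simp only [hexp]
    rw [integral_add hi12 hi3, integral_add hi1 hi2, integral_const_mul,
      hzw k k le_rfl β]
    have hG' : ∫ ω, ‖Q (G (z k ω))‖ ^ 2 ∂ν ≤ ρ ^ 2 * ∫ ω, ‖Q (z k ω)‖ ^ 2 ∂ν := by
      rw [← integral_const_mul]
      refine integral_mono hi1 ((hint (hmem k)).const_mul _) fun ω => ?_
      simp only
      rw [← mul_pow]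
      gcongr
      exact hG _
    have h1 : ρ ^ 2 * ∫ ω, ‖Q (z k ω)‖ ^ 2 ∂ν
        ≤ ρ ^ 2 * (ρ ^ (2 * k) * ‖Q z₀‖ ^ 2 + τ / (1 - ρ)) := by gcongr
    -- After multiplication by `1 - ρ` this is `τρ² ≤ τρ`.
    have h2 : ρ ^ 2 * (τ / (1 - ρ)) + τ ≤ τ / (1 - ρ) := by
      have h1ρ : 0 < 1 - ρ := by linarith
      rw [mul_div_assoc', div_add' _ _ _ h1ρ.ne', div_le_div_iff_of_pos_right h1ρ]
      nlinarith [mul_nonneg hτ0 (mul_nonneg hρ0 h1ρ.le)]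
    have h3 : ρ ^ (2 * (k + 1)) * ‖Q z₀‖ ^ 2 = ρ ^ 2 * (ρ ^ (2 * k) * ‖Q z₀‖ ^ 2) := by ring
    have h4 := hτ k
    rw [h3]
    linarith

end Stochastic

/-! ### Gradients of the objective, linear dynamics and Jordan coordinates -/

section Dynamics

variable {n m : ℕ}

/-- By symmetry of `C` the first-order remainder is exactly `½ hᵀCh`, which is `O(‖h‖²)`. -/
theorem hasGradientAt_quadratic {C : Matrix (Fin n) (Fin n) ℝ} (hC : C.IsSymm) (a : ℝ)
    (b : Fin n → ℝ) (x₀ x : Eucl n) :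
    HasGradientAt (fun x : Eucl n => a + (x - x₀).ofLp ⬝ᵥ b
        + (1 / 2) * ((x - x₀).ofLp ⬝ᵥ (C *ᵥ (x - x₀).ofLp)))
      (WithLp.toLp 2 (b + C *ᵥ (x - x₀).ofLp)) x := by
  rw [hasGradientAt_iff_isLittleO_nhds_zero]
  have h1 : ∀ h : Eucl n, (a + (x + h - x₀).ofLp ⬝ᵥ b
        + (1 / 2) * ((x + h - x₀).ofLp ⬝ᵥ (C *ᵥ (x + h - x₀).ofLp)))
      - (a + (x - x₀).ofLp ⬝ᵥ b + (1 / 2) * ((x - x₀).ofLp ⬝ᵥ (C *ᵥ (x - x₀).ofLp)))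
      - inner ℝ (WithLp.toLp 2 (b + C *ᵥ (x - x₀).ofLp)) h
      = (1 / 2) * (h.ofLp ⬝ᵥ (C *ᵥ h.ofLp)) := by
    intro h
    have e1 : inner ℝ (WithLp.toLp 2 (b + C *ᵥ (x - x₀).ofLp)) h
        = h.ofLp ⬝ᵥ (b + C *ᵥ (x - x₀).ofLp) := by
      conv_lhs => rw [← WithLp.toLp_ofLp 2 h]
      rw [EuclideanSpace.inner_toLp_toLp, star_trivial]
    have e2 : (x + h - x₀).ofLp = (x - x₀).ofLp + h.ofLp := by
      ext i
      simp
      ring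
    rw [e1, e2]
    generalize (x - x₀).ofLp = d
    rw [Matrix.mulVec_add]
    simp only [add_dotProduct, dotProduct_add]
    rw [dotProduct_mulVec_symm hC d h.ofLp]
    ring
  simp only [h1]
  have h2 : (fun h : Eucl n => (1 / 2) * (h.ofLp ⬝ᵥ (C *ᵥ h.ofLp)))
      =O[nhds 0] fun h : Eucl n => ‖h‖ ^ 2 := by
    refine Asymptotics.IsBigO.of_bound ‖C‖ (Filter.Eventually.of_forall fun h => ?_)
    have := abs_quadForm_le (le_refl ‖C‖) h.ofLp
    rw [dotProduct_eq_norm_sq] at this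
    have h0 := abs_nonneg (h.ofLp ⬝ᵥ (C *ᵥ h.ofLp))
    rw [norm_mul, Real.norm_eq_abs (h.ofLp ⬝ᵥ _), norm_pow, norm_norm]
    norm_num
    linarith
  exact h2.trans_isLittleO (Asymptotics.isLittleO_norm_pow_id one_lt_two)

theorem partialGrads_quadFun {A : Matrix (Fin m) (Fin m) ℝ} (B : Matrix (Fin n) (Fin m) ℝ)
    {C : Matrix (Fin n) (Fin n) ℝ} (hA : A.IsSymm) (hC : C.IsSymm) (zs z : Eucl n × Eucl m) :
    partialGrads (quadFun A B C zs) z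
      = (WithLp.toLp 2 (B *ᵥ (z.2 - zs.2).ofLp + C *ᵥ (z.1 - zs.1).ofLp),
        WithLp.toLp 2 (Bᵀ *ᵥ (z.1 - zs.1).ofLp + (-A) *ᵥ (z.2 - zs.2).ofLp)) := by
  refine Prod.ext ?_ ?_
  · exact (hasGradientAt_quadratic hC _ _ zs.1 z.1).gradient
  · have h := hasGradientAt_quadratic (C := -A) (by simpa [Matrix.IsSymm] using hA)
      ((1 / 2) * ((z.1 - zs.1).ofLp ⬝ᵥ (C *ᵥ (z.1 - zs.1).ofLp)))
      (Bᵀ *ᵥ (z.1 - zs.1).ofLp) zs.2 z.2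
    refine HasGradientAt.gradient ?_
    convert h using 2 with y
    rw [quadFun, dotProduct_mulVec_transpose, Matrix.neg_mulVec, dotProduct_neg]
    ring

/-- The linear map `z ↦ M z`. -/
def genLin (A : Matrix (Fin m) (Fin m) ℝ) (B : Matrix (Fin n) (Fin m) ℝ)
    (C : Matrix (Fin n) (Fin n) ℝ) (r : ℝ) : Eucl n × Eucl m →L[ℝ] Eucl n × Eucl m :=
  LinearMap.toContinuousLinearMap
    { toFun := fun z => (WithLp.toLp 2 (-(C *ᵥ z.1.ofLp) - B *ᵥ z.2.ofLp),
        WithLp.toLp 2 (r • (Bᵀ *ᵥ z.1.ofLp - A *ᵥ z.2.ofLp)))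
      map_add' := fun z w => by
        refine Prod.ext ?_ ?_
        · ext i
          simp [Matrix.mulVec_add]
          ring
        · ext i
          simp [Matrix.mulVec_add]
          ring
      map_smul' := fun c z => by
        refine Prod.ext ?_ ?_
        · ext i
          simp [Matrix.mulVec_smul]
          ring
        · ext i
          simp [Matrix.mulVec_smul]
          ring }

theorem genLin_apply (A : Matrix (Fin m) (Fin m) ℝ) (B : Matrix (Fin n) (Fin m) ℝ)
    (C : Matrix (Fin n) (Fin n) ℝ) (r : ℝ) (z : Eucl n × Eucl m) :
    genLin A B C r z = (WithLp.toLp 2 (-(C *ᵥ z.1.ofLp) - B *ᵥ z.2.ofLp),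
        WithLp.toLp 2 (r • (Bᵀ *ᵥ z.1.ofLp - A *ᵥ z.2.ofLp))) := rfl

/-- The effect `(ξ_x, ξ_y) ↦ (-η_x ξ_x, η_y ξ_y)` of the gradient noise on a step. -/
def noiseLin (n m : ℕ) (ηx ηy : ℝ) : Eucl n × Eucl m →L[ℝ] Eucl n × Eucl m :=
  ((-ηx) • ContinuousLinearMap.id ℝ (Eucl n)).prodMap (ηy • ContinuousLinearMap.id ℝ (Eucl m))

theorem noiseLin_apply (ηx ηy : ℝ) (z : Eucl n × Eucl m) :
    noiseLin n m ηx ηy z = (-ηx • z.1, ηy • z.2) := rfl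

/-- The base point `w` and the query point `z` are kept apart because they differ in the second half
of an EG step. The relation `η_y = r η_x` absorbs both stepsizes into `η_x M`. -/
theorem descentAscent_sub {A : Matrix (Fin m) (Fin m) ℝ} (B : Matrix (Fin n) (Fin m) ℝ)
    {C : Matrix (Fin n) (Fin n) ℝ} (hA : A.IsSymm) (hC : C.IsSymm) (zs w z g : Eucl n × Eucl m)
    {ηx ηy r : ℝ} (hη : ηy = r * ηx) :
    descentAscent ηx ηy w g - zs = (w - zs) + ηx • genLin A B C r (z - zs)
      + noiseLin n m ηx ηy (g - partialGrads (quadFun A B C zs) z) := by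
  rw [partialGrads_quadFun B hA hC, genLin_apply, noiseLin_apply, descentAscent]
  refine Prod.ext ?_ ?_
  · ext i
    simp
    ring
  · ext i
    simp [hη, Matrix.neg_mulVec]
    ring

/-- The coordinates of `(x, y)` in the usual order, as complex numbers. -/
def stack (z : Eucl n × Eucl m) : Fin (n + m) → ℂ :=
  fun k => ((Sum.elim z.1.ofLp z.2.ofLp (finSumFinEquiv.symm k) : ℝ) : ℂ)

theorem norm_stack (z : Eucl n × Eucl m) :
    ‖WithLp.toLp 2 (stack z)‖ = ‖WithLp.toLp 2 z‖ := by
  have h : ‖WithLp.toLp 2 (stack z)‖ ^ 2 = ‖WithLp.toLp 2 z‖ ^ 2 := by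
    rw [EuclideanSpace.norm_sq_eq, WithLp.prod_norm_sq_eq_of_L2, ← finSumFinEquiv.sum_comp,
      Fintype.sum_sum_type, EuclideanSpace.norm_sq_eq, EuclideanSpace.norm_sq_eq]
    simp [stack]
  exact (pow_left_inj₀ (norm_nonneg _) (norm_nonneg _) two_ne_zero).mp h

theorem stack_genLin (A : Matrix (Fin m) (Fin m) ℝ) (B : Matrix (Fin n) (Fin m) ℝ)
    (C : Matrix (Fin n) (Fin n) ℝ) (r : ℝ) (z : Eucl n × Eucl m) :
    stack (genLin A B C r z) = complexMat (matM A B C r) *ᵥ stack z := by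
  have hv : matM A B C r *ᵥ Sum.elim z.1.ofLp z.2.ofLp
      = Sum.elim (genLin A B C r z).1.ofLp (genLin A B C r z).2.ofLp := by
    rw [matM, Matrix.fromBlocks_mulVec]
    ext k
    cases k <;> simp [genLin_apply, Matrix.neg_mulVec, Matrix.smul_mulVec, sub_eq_add_neg]
  ext k
  obtain ⟨k, rfl⟩ := finSumFinEquiv.surjective k
  rw [complexMat_mulVec]
  simp only [stack, Equiv.symm_apply_apply]
  rw [← hv, Matrix.mulVec, dotProduct]
  push_cast
  rfl

theorem norm_toLp_mulVec_le {N : ℕ} (M : Matrix (Fin N) (Fin N) ℂ) (w : Fin N → ℂ) :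
    ‖WithLp.toLp 2 (M *ᵥ w)‖ ≤ ‖M‖ * ‖WithLp.toLp 2 w‖ :=
  Matrix.l2_opNorm_mulVec M (WithLp.toLp 2 w)

/-- The change of coordinates `z ↦ P z`. -/
def coordLin (P : Matrix (Fin (n + m)) (Fin (n + m)) ℂ) :
    Eucl n × Eucl m →L[ℝ] EuclideanSpace ℂ (Fin (n + m)) :=
  LinearMap.toContinuousLinearMap
    { toFun := fun z => WithLp.toLp 2 (P *ᵥ stack z)
      map_add' := fun z w => by
        have : stack (z + w) = stack z + stack w := by
          ext k
          obtain ⟨k, rfl⟩ := finSumFinEquiv.surjective k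
          cases k <;> simp [stack]
        rw [this, Matrix.mulVec_add, WithLp.toLp_add]
      map_smul' := fun c z => by
        have : stack (c • z) = (c : ℂ) • stack z := by
          ext k
          obtain ⟨k, rfl⟩ := finSumFinEquiv.surjective k
          cases k <;> simp [stack]
        rw [this, Matrix.mulVec_smul, WithLp.toLp_smul]
        rfl }

theorem coordLin_apply (P : Matrix (Fin (n + m)) (Fin (n + m)) ℂ) (z : Eucl n × Eucl m) :
    coordLin P z = WithLp.toLp 2 (P *ᵥ stack z) := rfl

theorem norm_coordLin_le (P : Matrix (Fin (n + m)) (Fin (n + m)) ℂ) (z : Eucl n × Eucl m) :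
    ‖coordLin P z‖ ≤ ‖P‖ * ‖WithLp.toLp 2 z‖ := by
  rw [← norm_stack]
  exact norm_toLp_mulVec_le P _

theorem norm_le_coordLin {P : Matrix (Fin (n + m)) (Fin (n + m)) ℂ} (hP : IsUnit P.det)
    (z : Eucl n × Eucl m) : ‖WithLp.toLp 2 z‖ ≤ ‖P⁻¹‖ * ‖coordLin P z‖ := by
  have h := norm_toLp_mulVec_le P⁻¹ (P *ᵥ stack z)
  rwa [Matrix.mulVec_mulVec, Matrix.nonsing_inv_mul _ hP, Matrix.one_mulVec,
    norm_stack] at h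

theorem coordLin_genLin {A : Matrix (Fin m) (Fin m) ℝ} {B : Matrix (Fin n) (Fin m) ℝ}
    {C : Matrix (Fin n) (Fin n) ℝ} {r : ℝ} {P J : Matrix (Fin (n + m)) (Fin (n + m)) ℂ} {δ : ℝ}
    (h : IsJordanDecomp (matM A B C r) P J δ) (z : Eucl n × Eucl m) :
    (coordLin P (genLin A B C r z)).ofLp = J *ᵥ (coordLin P z).ofLp := by
  obtain ⟨hP, -, hM⟩ := h
  rw [coordLin_apply, coordLin_apply, stack_genLin, complexMat, hM, Matrix.mulVec_mulVec,
    Matrix.mulVec_mulVec, ← Matrix.mul_assoc, ← Matrix.mul_assoc, Matrix.mul_nonsing_inv _ hP,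
    Matrix.one_mul]

theorem norm_sq_noiseLin_le {ηx ηy : ℝ} (h0 : 0 ≤ ηx) (h : ηx ≤ ηy) (z : Eucl n × Eucl m) :
    ‖WithLp.toLp 2 (noiseLin n m ηx ηy z)‖ ^ 2 ≤ ηy ^ 2 * (‖z.1‖ ^ 2 + ‖z.2‖ ^ 2) := by
  rw [WithLp.prod_norm_sq_eq_of_L2]
  change ‖-ηx • z.1‖ ^ 2 + ‖ηy • z.2‖ ^ 2 ≤ _
  rw [norm_smul, norm_smul, norm_neg, mul_pow, mul_pow, Real.norm_of_nonneg h0,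
    Real.norm_of_nonneg (h0.trans h), mul_add]
  gcongr

end Dynamics

/-! ### Moments of the gradient noise -/

section Noise

variable {n m : ℕ} {Ω : Type u} [MeasurableSpace Ω] {ν : Measure Ω}
  {ξ : ℕ → Ω → Eucl n × Eucl m} {σ : ℝ} {S : ℕ}

theorem NoiseAssumption.memLp (h : NoiseAssumption ν ξ σ S) (j : ℕ) : MemLp (ξ j) 2 ν :=
  memLp_prod_iff.mpr ⟨h.memLp_x j, h.memLp_y j⟩

theorem NoiseAssumption.integral_eq_zero [IsProbabilityMeasure ν] (h : NoiseAssumption ν ξ σ S)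
    (j : ℕ) : ∫ ω, ξ j ω ∂ν = 0 := by
  have hi : Integrable (ξ j) ν := (h.memLp j).integrable (by norm_num)
  refine Prod.ext ?_ ?_
  · rw [fst_integral hi, h.mean_x]
    rfl
  · rw [snd_integral hi, h.mean_y]
    rfl

theorem NoiseAssumption.uncorrelated [IsProbabilityMeasure ν] (h : NoiseAssumption ν ξ σ S)
    {i j : ℕ} (hij : i ≠ j) : Uncorrelated ν (ξ i) (ξ j) :=
  uncorrelated_of_indepFun (h.indep.indepFun hij) ((h.memLp i).integrable (by norm_num))
    ((h.memLp j).integrable (by norm_num)) (h.integral_eq_zero i)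

theorem NoiseAssumption.integral_norm_sq_coordLin_le [IsProbabilityMeasure ν]
    (h : NoiseAssumption ν ξ σ S) (P : Matrix (Fin (n + m)) (Fin (n + m)) ℂ) {ηx ηy : ℝ}
    (h0 : 0 ≤ ηx) (hη : ηx ≤ ηy) (j : ℕ) :
    ∫ ω, ‖coordLin P (noiseLin n m ηx ηy (ξ j ω))‖ ^ 2 ∂ν
      ≤ ‖P‖ ^ 2 * (2 * ηy ^ 2 * (σ ^ 2 / S)) := by
  have hx := (h.memLp_x j).integrable_norm_pow (p := 2) (by norm_num)
  have hy := (h.memLp_y j).integrable_norm_pow (p := 2) (by norm_num)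
  have hi : Integrable (fun ω => ‖coordLin P (noiseLin n m ηx ηy (ξ j ω))‖ ^ 2) ν :=
    (((coordLin P).comp (noiseLin n m ηx ηy)).comp_memLp' (h.memLp j)).integrable_norm_pow
      (by norm_num)
  have hxy : Integrable (fun ω => ‖(ξ j ω).1‖ ^ 2 + ‖(ξ j ω).2‖ ^ 2) ν := hx.add hy
  calc _ ≤ ∫ ω, ‖P‖ ^ 2 * (ηy ^ 2 * (‖(ξ j ω).1‖ ^ 2 + ‖(ξ j ω).2‖ ^ 2)) ∂ν := by
        refine integral_mono hi ((hxy.const_mul _).const_mul _) fun ω => ?_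
        calc _ ≤ (‖P‖ * ‖WithLp.toLp 2 (noiseLin n m ηx ηy (ξ j ω))‖) ^ 2 := by
              gcongr
              exact norm_coordLin_le P _
          _ ≤ _ := by
              rw [mul_pow]
              gcongr
              exact norm_sq_noiseLin_le h0 hη _
    _ = ‖P‖ ^ 2 * (ηy ^ 2 * (∫ ω, ‖(ξ j ω).1‖ ^ 2 ∂ν + ∫ ω, ‖(ξ j ω).2‖ ^ 2 ∂ν)) := by
        rw [integral_const_mul, integral_const_mul, integral_add hx hy]
    _ ≤ ‖P‖ ^ 2 * (ηy ^ 2 * (σ ^ 2 / S + σ ^ 2 / S)) := by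
        gcongr
        · exact h.second_moment_x j
        · exact h.second_moment_y j
    _ = _ := by ring

end Noise

/-! ### One step of each algorithm as a linear map plus noise -/

section Steps

variable {n m : ℕ} {A : Matrix (Fin m) (Fin m) ℝ} {C : Matrix (Fin n) (Fin n) ℝ} {Ω : Type u}
  {ηx ηy r : ℝ}

/-- The linear map `1 + η M`. -/
def gdaLin (A : Matrix (Fin m) (Fin m) ℝ) (B : Matrix (Fin n) (Fin m) ℝ)
    (C : Matrix (Fin n) (Fin n) ℝ) (r η : ℝ) : Eucl n × Eucl m →L[ℝ] Eucl n × Eucl m :=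
  ContinuousLinearMap.id ℝ (Eucl n × Eucl m) + η • genLin A B C r

theorem gdaLin_apply (A : Matrix (Fin m) (Fin m) ℝ) (B : Matrix (Fin n) (Fin m) ℝ)
    (C : Matrix (Fin n) (Fin n) ℝ) (r η : ℝ) (z : Eucl n × Eucl m) :
    gdaLin A B C r η z = z + η • genLin A B C r z := rfl

/-- The linear map `1 + η M (1 + η M)`. -/
def egLin (A : Matrix (Fin m) (Fin m) ℝ) (B : Matrix (Fin n) (Fin m) ℝ)
    (C : Matrix (Fin n) (Fin n) ℝ) (r η : ℝ) : Eucl n × Eucl m →L[ℝ] Eucl n × Eucl m :=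
  ContinuousLinearMap.id ℝ (Eucl n × Eucl m) + (η • genLin A B C r).comp (gdaLin A B C r η)

theorem egLin_apply (A : Matrix (Fin m) (Fin m) ℝ) (B : Matrix (Fin n) (Fin m) ℝ)
    (C : Matrix (Fin n) (Fin n) ℝ) (r η : ℝ) (z : Eucl n × Eucl m) :
    egLin A B C r η z = z + η • genLin A B C r (z + η • genLin A B C r z) := rfl

theorem sgda_step (B : Matrix (Fin n) (Fin m) ℝ) (hA : A.IsSymm) (hC : C.IsSymm)
    (hη : ηy = r * ηx) (g : Oracle Ω n m) (zs z₀ : Eucl n × Eucl m) (k : ℕ) (ω : Ω) :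
    sgda g ηx ηy z₀ (k + 1) ω - zs = gdaLin A B C r ηx (sgda g ηx ηy z₀ k ω - zs)
      + noiseLin n m ηx ηy (gradNoise (quadFun A B C zs) g (sgda g ηx ηy z₀) k ω) := by
  rw [sgda, descentAscent_sub B hA hC zs _ (sgda g ηx ηy z₀ k ω) _ hη, gdaLin_apply, gradNoise]

/-- The noise of the extrapolation call reaches `z^{k+1}` only through the second gradient, hence
multiplied by `ηM`; the noise of the second call enters directly. -/
theorem seg_step (B : Matrix (Fin n) (Fin m) ℝ) (hA : A.IsSymm) (hC : C.IsSymm)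
    (hη : ηy = r * ηx) (g : Oracle Ω n m) (zs z₀ : Eucl n × Eucl m) (k : ℕ) (ω : Ω) :
    seg g ηx ηy z₀ (k + 1) ω - zs = egLin A B C r ηx (seg g ηx ηy z₀ k ω - zs)
      + (((ηx • genLin A B C r).comp (noiseLin n m ηx ηy))
            (gradNoise (quadFun A B C zs) g (segQuery g ηx ηy z₀) (2 * k) ω)
        + noiseLin n m ηx ηy
            (gradNoise (quadFun A B C zs) g (segQuery g ηx ηy z₀) (2 * k + 1) ω)) := by
  have hq0 : segQuery g ηx ηy z₀ (2 * k) ω = seg g ηx ηy z₀ k ω := by simp [segQuery]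
  have hq1 : segQuery g ηx ηy z₀ (2 * k + 1) ω = segHalf g ηx ηy z₀ k ω := by
    have e1 : (2 * k + 1) % 2 = 1 := by omega
    have e2 : (2 * k + 1) / 2 = k := by omega
    simp [segQuery, e1, e2]
  have h1 : segHalf g ηx ηy z₀ k ω - zs = seg g ηx ηy z₀ k ω - zs
      + ηx • genLin A B C r (seg g ηx ηy z₀ k ω - zs)
      + noiseLin n m ηx ηy
          (gradNoise (quadFun A B C zs) g (segQuery g ηx ηy z₀) (2 * k) ω) := by
    rw [gradNoise, hq0, segHalf,
      descentAscent_sub B hA hC zs _ (seg g ηx ηy z₀ k ω) _ hη]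
  have h2 : seg g ηx ηy z₀ (k + 1) ω - zs = (seg g ηx ηy z₀ k ω - zs)
      + ηx • genLin A B C r (segHalf g ηx ηy z₀ k ω - zs)
      + noiseLin n m ηx ηy
          (gradNoise (quadFun A B C zs) g (segQuery g ηx ηy z₀) (2 * k + 1) ω) := by
    rw [gradNoise, hq1, seg, ← segHalf,
      descentAscent_sub B hA hC zs _ (segHalf g ηx ηy z₀ k ω) _ hη]
  rw [h2, h1, egLin_apply, map_add _ _ (noiseLin n m ηx ηy _), smul_add,
    ContinuousLinearMap.comp_apply, smul_apply, add_assoc, add_assoc, add_assoc]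

end Steps

/-! ### Convergence bounds for SGDA and stochastic EG -/

section Convergence

/-- The quadratic problem, the stepsize ratio and the Jordan decomposition. -/
structure IsJordanSetting {n m : ℕ} (A : Matrix (Fin m) (Fin m) ℝ)
    (B : Matrix (Fin n) (Fin m) ℝ) (C : Matrix (Fin n) (Fin n) ℝ) (L μ μx r : ℝ)
    (P J : Matrix (Fin (n + m)) (Fin (n + m)) ℂ) (δ : ℝ) : Prop where
  quad : IsQuadNCSC A B C L μ μx
  pos_m : 0 < m
  kappa_le : 2 * (L / μ) ≤ r
  delta_pos : 0 < δ
  delta_le : δ ≤ μx / 64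
  jordan : IsJordanDecomp (matM A B C r) P J δ

namespace IsJordanSetting

variable {n m : ℕ} {A : Matrix (Fin m) (Fin m) ℝ} {B : Matrix (Fin n) (Fin m) ℝ}
  {C : Matrix (Fin n) (Fin n) ℝ} {L μ μx r : ℝ}
  {P J : Matrix (Fin (n + m)) (Fin (n + m)) ℂ} {δ : ℝ}

theorem two_le_r (h : IsJordanSetting A B C L μ μx r P J δ) : 2 ≤ r := by
  have h1 : 1 ≤ L / μ := (one_le_div h.quad.mu_pos).mpr (h.quad.mu_le_L h.pos_m)
  linarith [h.kappa_le]

theorem two_mul_L_le (h : IsJordanSetting A B C L μ μx r P J δ) : 2 * L ≤ r * μ := by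
  have h1 := h.kappa_le
  rwa [← mul_div_assoc, div_le_iff₀ h.quad.mu_pos] at h1

theorem one_le_rate_inv (h : IsJordanSetting A B C L μ μx r P J δ) : 1 ≤ r * (L / μx) := by
  have h1 : 1 ≤ L / μx := (one_le_div h.quad.mux_pos).mpr h.quad.mux_le_L
  nlinarith [h.two_le_r]

theorem step_nonneg (h : IsJordanSetting A B C L μ μx r P J δ) : 0 ≤ 1 / (4 * r * L) := by
  have := h.quad.L_pos
  have := h.two_le_r
  positivity

theorem step_le (h : IsJordanSetting A B C L μ μx r P J δ) :
    1 / (4 * r * L) ≤ 1 / (4 * L) := by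
  have := h.quad.L_pos
  have := h.two_le_r
  apply one_div_le_one_div_of_le (by positivity)
  nlinarith

theorem step_eq (h : IsJordanSetting A B C L μ μx r P J δ) :
    1 / (4 * L) = r * (1 / (4 * r * L)) := by
  have := h.quad.L_pos
  have := h.two_le_r
  field_simp

/-- The restriction `δ ≤ μ_x/64` serves this: the off-diagonal part of `ηJ` stays well below the
contraction gap. -/
theorem step_mul_delta_le (h : IsJordanSetting A B C L μ μx r P J δ) :
    1 / (4 * r * L) * δ ≤ 1 / (r * (L / μx)) / 256 := by
  have := h.quad.L_pos
  have := h.two_le_r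
  have := h.quad.mux_pos
  calc 1 / (4 * r * L) * δ ≤ 1 / (4 * r * L) * (μx / 64) := by
        have := h.step_nonneg
        gcongr
        exact h.delta_le
    _ = _ := by field_simp; norm_num

theorem rate_nonneg (h : IsJordanSetting A B C L μ μx r P J δ) : 0 ≤ 1 / (r * (L / μx)) := by
  have := h.one_le_rate_inv
  positivity

theorem rate_le_one (h : IsJordanSetting A B C L μ μx r P J δ) : 1 / (r * (L / μx)) ≤ 1 := by
  have := h.one_le_rate_inv
  rw [div_le_one (by linarith)]
  exact this

theorem coordLin_smul_genLin (h : IsJordanSetting A B C L μ μx r P J δ) (η : ℝ)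
    (z : Eucl n × Eucl m) :
    coordLin P (η • genLin A B C r z)
      = WithLp.toLp 2 (((η : ℂ) • J) *ᵥ (coordLin P z).ofLp) := by
  rw [map_smul, Matrix.smul_mulVec, ← coordLin_genLin h.jordan]
  rfl

theorem norm_coordLin_smul_genLin_le (h : IsJordanSetting A B C L μ μx r P J δ)
    (z : Eucl n × Eucl m) :
    ‖coordLin P ((1 / (4 * r * L)) • genLin A B C r z)‖ ≤ 1 / 2 * ‖coordLin P z‖ := by
  rw [h.coordLin_smul_genLin]
  refine (norm_toLp_mulVec_le _ _).trans ?_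
  rw [WithLp.toLp_ofLp]
  gcongr
  exact norm_smul_jordan_le h.jordan.2.1 h.delta_pos.le h.step_nonneg h.rate_le_one
    h.step_mul_delta_le fun i => h.quad.stableAt h.two_mul_L_le h.two_le_r h.jordan i

theorem norm_coordLin_gda_le (h : IsJordanSetting A B C L μ μx r P J δ)
    (z : Eucl n × Eucl m) :
    ‖coordLin P (z + (1 / (4 * r * L)) • genLin A B C r z)‖
      ≤ (1 - 1 / (r * (L / μx)) / 40) * ‖coordLin P z‖ := by
  have e : coordLin P (z + (1 / (4 * r * L)) • genLin A B C r z)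
      = WithLp.toLp 2 ((1 + ((1 / (4 * r * L) : ℝ) : ℂ) • J) *ᵥ (coordLin P z).ofLp) := by
    rw [map_add, h.coordLin_smul_genLin, Matrix.add_mulVec, Matrix.one_mulVec, WithLp.toLp_add]
  rw [e]
  refine (norm_toLp_mulVec_le _ _).trans ?_
  rw [WithLp.toLp_ofLp]
  gcongr
  exact norm_one_add_jordan_le h.jordan.2.1 h.delta_pos.le h.step_nonneg h.rate_nonneg
    h.rate_le_one h.step_mul_delta_le
    fun i => h.quad.stableAt h.two_mul_L_le h.two_le_r h.jordan i

theorem norm_coordLin_eg_le (h : IsJordanSetting A B C L μ μx r P J δ)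
    (z : Eucl n × Eucl m) :
    ‖coordLin P (z + (1 / (4 * r * L)) • genLin A B C r
        (z + (1 / (4 * r * L)) • genLin A B C r z))‖
      ≤ (1 - 1 / (r * (L / μx)) / 40) * ‖coordLin P z‖ := by
  set η := 1 / (4 * r * L) with hη
  have e : coordLin P (z + η • genLin A B C r (z + η • genLin A B C r z))
      = WithLp.toLp 2 ((1 + (η : ℂ) • J + ((η : ℂ) • J) * ((η : ℂ) • J))
        *ᵥ (coordLin P z).ofLp) := by
    rw [map_add, h.coordLin_smul_genLin, map_add, h.coordLin_smul_genLin, Matrix.add_mulVec,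
      Matrix.add_mulVec, Matrix.one_mulVec, ← Matrix.mulVec_mulVec, WithLp.ofLp_add,
      Matrix.mulVec_add, WithLp.toLp_add, WithLp.toLp_add, WithLp.toLp_add, WithLp.toLp_ofLp,
      add_assoc]
  rw [e]
  refine (norm_toLp_mulVec_le _ _).trans ?_
  rw [WithLp.toLp_ofLp]
  gcongr
  exact norm_one_add_add_sq_jordan_le h.jordan.2.1 h.delta_pos.le h.step_nonneg h.rate_nonneg
    h.rate_le_one h.step_mul_delta_le
    fun i => h.quad.stableAt h.two_mul_L_le h.two_le_r h.jordan i

variable {Ω : Type u} [MeasurableSpace Ω] {ν : Measure Ω} [IsProbabilityMeasure ν]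

/-- The bound of `linear_iteration_bound` in terms of the Euclidean distance. -/
theorem dist2_bound (h : IsJordanSetting A B C L μ μx r P J δ)
    {G : Eucl n × Eucl m →L[ℝ] Eucl n × Eucl m} {z w : ℕ → Ω → Eucl n × Eucl m}
    {zs z₀ : Eucl n × Eucl m} {τ : ℝ}
    (hz0 : ∀ ω, z 0 ω = z₀) (hz : ∀ k ω, z (k + 1) ω - zs = G (z k ω - zs) + w k ω)
    (hw : ∀ k, MemLp (w k) 2 ν) (hmean : ∀ k, ∫ ω, w k ω ∂ν = 0)
    (hunc : ∀ j k, j ≠ k → Uncorrelated ν (w j) (w k))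
    (hG : ∀ v, ‖coordLin P (G v)‖ ≤ (1 - 1 / (r * (L / μx)) / 40) * ‖coordLin P v‖)
    (hτ : ∀ k, ∫ ω, ‖coordLin P (w k ω)‖ ^ 2 ∂ν ≤ ‖P‖ ^ 2 * τ) (T : ℕ) :
    Integrable (fun ω => dist2 (z T ω) zs ^ 2) ν ∧
    ∫ ω, dist2 (z T ω) zs ^ 2 ∂ν
      ≤ condNum P ^ 2 * (1 - (1 / 40) / (r * (L / μx))) ^ (2 * T) * dist2 z₀ zs ^ 2
        + 40 * (r * (L / μx)) * condNum P ^ 2 * τ := by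
  have hR := h.one_le_rate_inv
  set x := 1 / (r * (L / μx)) with hx
  have hx0 : 0 < x := by rw [hx]; positivity
  have hx1 : x ≤ 1 := h.rate_le_one
  obtain ⟨hmem, hbd⟩ := linear_iteration_bound (z := fun k ω => z k ω - zs) (z₀ := z₀ - zs)
    (Q := coordLin P) (fun ω => by rw [hz0]) hz hw hmean hunc (by linarith) (by linarith) hG hτ T
  have hiQ : Integrable (fun ω => ‖coordLin P (z T ω - zs)‖ ^ 2) ν :=
    ((coordLin P).comp_memLp' hmem).integrable_norm_pow (by norm_num)
  have hle : ∀ v : Eucl n × Eucl m,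
      ‖WithLp.toLp 2 v‖ ^ 2 ≤ ‖P⁻¹‖ ^ 2 * ‖coordLin P v‖ ^ 2 := by
    intro v
    rw [← mul_pow]
    gcongr
    exact norm_le_coordLin h.jordan.1 v
  have hint : Integrable (fun ω => dist2 (z T ω) zs ^ 2) ν := by
    refine (hiQ.const_mul (‖P⁻¹‖ ^ 2)).mono' ?_ (Filter.Eventually.of_forall fun ω => ?_)
    · have hc : Continuous fun v : Eucl n × Eucl m => ‖WithLp.toLp 2 v‖ ^ 2 := by fun_prop
      exact hc.comp_aestronglyMeasurable hmem.1
    · rw [Real.norm_of_nonneg (by positivity)]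
      exact hle _
  refine ⟨hint, ?_⟩
  calc _ ≤ ∫ ω, ‖P⁻¹‖ ^ 2 * ‖coordLin P (z T ω - zs)‖ ^ 2 ∂ν :=
        integral_mono hint (hiQ.const_mul _) fun ω => hle _
    _ = ‖P⁻¹‖ ^ 2 * ∫ ω, ‖coordLin P (z T ω - zs)‖ ^ 2 ∂ν := integral_const_mul _ _
    -- Returning from `‖P ·‖` costs `‖P⁻¹‖`, entering it costs `‖P‖`, at the initial point and in
    -- the noise alike; together they form `C_P`.
    _ ≤ ‖P⁻¹‖ ^ 2 * ((1 - x / 40) ^ (2 * T) * (‖P‖ * dist2 z₀ zs) ^ 2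
        + ‖P‖ ^ 2 * τ / (1 - (1 - x / 40))) := by
        gcongr
        refine hbd.trans ?_
        have : 0 ≤ 1 - x / 40 := by linarith
        gcongr
        exact norm_coordLin_le P _
    _ = _ := by
        have e1 : 1 - (1 - x / 40) = x / 40 := by ring
        have e2 : 1 / 40 / (r * (L / μx)) = x / 40 := by rw [hx]; ring
        have e3 : r * (L / μx) = 1 / x := by rw [hx, one_div_one_div]
        rw [e1, e2, e3, condNum]
        field_simp

variable {σ : ℝ} {S : ℕ} {g : Oracle Ω n m} {zs z₀ : Eucl n × Eucl m}

/-- The factor `5` is the one of the EG noise and also covers the `2` of GDA. It gives `40 · 5/16 =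
25/2 ≤ 13`. -/
theorem noise_term_le (h : IsJordanSetting A B C L μ μx r P J δ) :
    40 * (r * (L / μx)) * condNum P ^ 2 * (5 * (1 / (4 * L)) ^ 2 * (σ ^ 2 / S))
      ≤ 13 * r * (L / μx) * condNum P ^ 2 * σ ^ 2 / (L ^ 2 * S) := by
  have hR := h.one_le_rate_inv
  have hL := h.quad.L_pos
  have e : 40 * (r * (L / μx)) * condNum P ^ 2 * (5 * (1 / (4 * L)) ^ 2 * (σ ^ 2 / S))
      = 25 / 2 * ((r * (L / μx)) * condNum P ^ 2 * σ ^ 2 / (L ^ 2 * S)) := by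
    rw [div_pow, mul_pow]
    ring
  rw [e]
  have : 0 ≤ (r * (L / μx)) * condNum P ^ 2 * σ ^ 2 / (L ^ 2 * S) := by positivity
  calc _ ≤ 13 * ((r * (L / μx)) * condNum P ^ 2 * σ ^ 2 / (L ^ 2 * S)) := by linarith
    _ = _ := by ring

theorem sgda_bound (h : IsJordanSetting A B C L μ μx r P J δ)
    (hN : NoiseAssumption ν (gradNoise (quadFun A B C zs) g
      (sgda g (1 / (4 * r * L)) (1 / (4 * L)) z₀)) σ S) (T : ℕ) :
    Integrable (fun ω => dist2 (sgda g (1 / (4 * r * L)) (1 / (4 * L)) z₀ T ω) zs ^ 2) ν ∧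
    ∫ ω, dist2 (sgda g (1 / (4 * r * L)) (1 / (4 * L)) z₀ T ω) zs ^ 2 ∂ν
      ≤ condNum P ^ 2 * (1 - (1 / 40) / (r * (L / μx))) ^ (2 * T) * dist2 z₀ zs ^ 2
        + 13 * r * (L / μx) * condNum P ^ 2 * σ ^ 2 / (L ^ 2 * S) := by
  obtain ⟨hi, hb⟩ := h.dist2_bound (zs := zs) (z₀ := z₀) (fun ω => rfl)
    (sgda_step B h.quad.symm_A h.quad.symm_C h.step_eq g zs z₀)
    (fun k => (noiseLin n m _ _).comp_memLp' (hN.memLp k))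
    (fun k => by
      rw [(noiseLin n m _ _).integral_comp_comm ((hN.memLp k).integrable (by norm_num)),
        hN.integral_eq_zero, map_zero])
    (fun j k hjk => (hN.uncorrelated hjk).comp _ _)
    h.norm_coordLin_gda_le
    (fun k => (hN.integral_norm_sq_coordLin_le P h.step_nonneg h.step_le k).trans
      (by gcongr; norm_num : _ ≤ ‖P‖ ^ 2 * (5 * (1 / (4 * L)) ^ 2 * (σ ^ 2 / S)))) T
  exact ⟨hi, hb.trans (add_le_add_right h.noise_term_le _)⟩

/-- The noise of a step of EG. -/
theorem integral_norm_sq_egNoise_le (h : IsJordanSetting A B C L μ μx r P J δ)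
    {ξ : ℕ → Ω → Eucl n × Eucl m} (hN : NoiseAssumption ν ξ σ S) (i j : ℕ) :
    ∫ ω, ‖coordLin P ((((1 / (4 * r * L)) • genLin A B C r).comp
        (noiseLin n m (1 / (4 * r * L)) (1 / (4 * L)))) (ξ i ω)
        + noiseLin n m (1 / (4 * r * L)) (1 / (4 * L)) (ξ j ω))‖ ^ 2 ∂ν
      ≤ ‖P‖ ^ 2 * (5 * (1 / (4 * L)) ^ 2 * (σ ^ 2 / S)) := by
  have hb := hN.integral_norm_sq_coordLin_le P h.step_nonneg h.step_le
  have hQK := h.norm_coordLin_smul_genLin_le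
  generalize 1 / (4 * L) = ηy at *
  generalize 1 / (4 * r * L) = ηx at *
  set D := noiseLin n m ηx ηy
  set K := (ηx • genLin A B C r).comp D
  have hmK : ∀ j, MemLp (fun ω => K (ξ j ω)) 2 ν := fun j => K.comp_memLp' (hN.memLp j)
  have hmD : ∀ j, MemLp (fun ω => D (ξ j ω)) 2 ν := fun j => D.comp_memLp' (hN.memLp j)
  have hi : ∀ j, Integrable (fun ω => ‖coordLin P (D (ξ j ω))‖ ^ 2) ν := fun j =>
    ((coordLin P).comp_memLp' (hmD j)).integrable_norm_pow (by norm_num)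
  have hi' : Integrable (fun ω => ‖coordLin P (K (ξ i ω) + D (ξ j ω))‖ ^ 2) ν :=
    ((coordLin P).comp_memLp' ((hmK i).add (hmD j))).integrable_norm_pow (by norm_num)
  -- Since `‖ηJ‖ ≤ 1/2`, the bound `(a/2 + b)² ≤ a²/2 + 2b²` applies pointwise. With a second moment
  -- proportional to `2` for each call, the total is `½·2 + 2·2 = 5`.
  calc _ ≤ ∫ ω, (1 / 2 * ‖coordLin P (D (ξ i ω))‖ ^ 2
        + 2 * ‖coordLin P (D (ξ j ω))‖ ^ 2) ∂ν := by
        refine integral_mono hi' (((hi _).const_mul _).add ((hi _).const_mul _)) fun ω => ?_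
        have h1 : ‖coordLin P (K (ξ i ω))‖ ≤ 1 / 2 * ‖coordLin P (D (ξ i ω))‖ :=
          hQK (D (ξ i ω))
        have h2 : ‖coordLin P (K (ξ i ω) + D (ξ j ω))‖
            ≤ 1 / 2 * ‖coordLin P (D (ξ i ω))‖ + ‖coordLin P (D (ξ j ω))‖ := by
          rw [map_add]
          exact (norm_add_le _ _).trans (by gcongr)
        calc _ ≤ (1 / 2 * ‖coordLin P (D (ξ i ω))‖ + ‖coordLin P (D (ξ j ω))‖) ^ 2 := by
              gcongr
          _ ≤ _ := by
              nlinarith [sq_nonneg (1 / 2 * ‖coordLin P (D (ξ i ω))‖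
                - ‖coordLin P (D (ξ j ω))‖)]
    _ = 1 / 2 * ∫ ω, ‖coordLin P (D (ξ i ω))‖ ^ 2 ∂ν
        + 2 * ∫ ω, ‖coordLin P (D (ξ j ω))‖ ^ 2 ∂ν := by
        rw [integral_add ((hi _).const_mul _) ((hi _).const_mul _), integral_const_mul,
          integral_const_mul]
    _ ≤ 1 / 2 * (‖P‖ ^ 2 * (2 * ηy ^ 2 * (σ ^ 2 / S)))
        + 2 * (‖P‖ ^ 2 * (2 * ηy ^ 2 * (σ ^ 2 / S))) := by
        gcongr
        · exact hb _
        · exact hb _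
    _ = _ := by ring

theorem seg_bound (h : IsJordanSetting A B C L μ μx r P J δ)
    (hN : NoiseAssumption ν (gradNoise (quadFun A B C zs) g
      (segQuery g (1 / (4 * r * L)) (1 / (4 * L)) z₀)) σ S) (T : ℕ) :
    Integrable (fun ω => dist2 (seg g (1 / (4 * r * L)) (1 / (4 * L)) z₀ T ω) zs ^ 2) ν ∧
    ∫ ω, dist2 (seg g (1 / (4 * r * L)) (1 / (4 * L)) z₀ T ω) zs ^ 2 ∂ν
      ≤ condNum P ^ 2 * (1 - (1 / 40) / (r * (L / μx))) ^ (2 * T) * dist2 z₀ zs ^ 2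
        + 13 * r * (L / μx) * condNum P ^ 2 * σ ^ 2 / (L ^ 2 * S) := by
  have hm : ∀ (V : Eucl n × Eucl m →L[ℝ] Eucl n × Eucl m) (j : ℕ), MemLp (fun ω => V
      (gradNoise (quadFun A B C zs) g (segQuery g (1 / (4 * r * L)) (1 / (4 * L)) z₀) j ω)) 2 ν :=
    fun V j => V.comp_memLp' (hN.memLp j)
  have hmean0 : ∀ (V : Eucl n × Eucl m →L[ℝ] Eucl n × Eucl m) (j : ℕ), ∫ ω, V
      (gradNoise (quadFun A B C zs) g (segQuery g (1 / (4 * r * L)) (1 / (4 * L)) z₀) j ω) ∂ν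
      = 0 := by
    intro V j
    rw [V.integral_comp_comm ((hN.memLp j).integrable (by norm_num)), hN.integral_eq_zero,
      map_zero]
  obtain ⟨hi, hb⟩ := h.dist2_bound (zs := zs) (z₀ := z₀) (fun ω => rfl)
    (seg_step B h.quad.symm_A h.quad.symm_C h.step_eq g zs z₀)
    (fun k => (hm _ _).add (hm _ _))
    (fun k => by
      rw [integral_add ((hm _ _).integrable (by norm_num)) ((hm _ _).integrable (by norm_num)),
        hmean0, hmean0, add_zero])
    -- Different steps use disjoint pairs of calls, so all four cross terms vanish.
    (fun j k hjk => Uncorrelated.add_left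
      (((hN.uncorrelated (by omega)).comp _ _).add_right ((hN.uncorrelated (by omega)).comp _ _)
        (hm _ _) (hm _ _) (hm _ _))
      (((hN.uncorrelated (by omega)).comp _ _).add_right ((hN.uncorrelated (by omega)).comp _ _)
        (hm _ _) (hm _ _) (hm _ _))
      (hm _ _) (hm _ _) ((hm _ _).add (hm _ _)))
    h.norm_coordLin_eg_le (fun k => h.integral_norm_sq_egNoise_le hN _ _) T
  exact ⟨hi, hb.trans (add_le_add_right h.noise_term_le _)⟩

end IsJordanSetting

end Convergence

/-! ### Number of steps and batch size -/

section Complexity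

/-- By `1 - u ≤ e^{-u}`, the choice `T ≥ 80Rℓ` with `ℓ = max(1, log y)` makes the power at most
`e^{-2ℓ}`. One `ℓ` cancels `y` and the other leaves `e^{-1}`. -/
theorem mul_pow_le_half {R y : ℝ} (hR : 1 ≤ R) (hy : 0 ≤ y) {T : ℕ}
    (hT : 80 * R * max 1 (Real.log y) ≤ T) : y * (1 - (1 / 40) / R) ^ T ≤ 1 / 2 := by
  have hx1 : (1 / 40) / R ≤ 1 := by rw [div_le_one (by linarith)]; linarith
  have h1 : (1 - (1 / 40) / R) ^ T ≤ Real.exp (-(2 * max 1 (Real.log y))) := by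
    calc (1 - (1 / 40) / R) ^ T ≤ Real.exp (-((1 / 40) / R)) ^ T := by
          have h2 : 1 - (1 / 40) / R ≤ Real.exp (-((1 / 40) / R)) := by
            linarith [Real.add_one_le_exp (-((1 / 40) / R))]
          have : 0 ≤ 1 - (1 / 40) / R := by linarith
          gcongr
      _ = Real.exp (-(T * ((1 / 40) / R))) := by rw [← Real.exp_nat_mul]; ring_nf
      _ ≤ _ := by
          refine Real.exp_le_exp.mpr (neg_le_neg ?_)
          calc 2 * max 1 (Real.log y) = (80 * R * max 1 (Real.log y)) * ((1 / 40) / R) := by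
                field_simp
                norm_num
            _ ≤ _ := by gcongr
  have he : Real.exp (-1) ≤ 1 / 2 := by
    rw [Real.exp_neg, ← one_div]
    exact one_div_le_one_div_of_le (by norm_num) (by linarith [Real.add_one_le_exp 1])
  calc y * (1 - (1 / 40) / R) ^ T ≤ y * Real.exp (-(2 * max 1 (Real.log y))) := by gcongr
    _ ≤ Real.exp (-1) := by
      -- For `y = 0` the value `Real.log 0 = 0` gives the same maximum as `-∞` would.
      rcases hy.eq_or_lt with rfl | hy'
      · simp [Real.exp_nonneg]
      · calc y * Real.exp (-(2 * max 1 (Real.log y)))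
            = Real.exp (Real.log y + -(2 * max 1 (Real.log y))) := by
              rw [Real.exp_add, Real.exp_log hy']
          _ ≤ _ := by
              gcongr
              linarith [le_max_left 1 (Real.log y), le_max_right 1 (Real.log y)]
    _ ≤ _ := he

/-- A sufficient number of steps `T` and batch size `S`, with their cost, when the squared error
obeys the bound of the convergence theorem. -/
theorem exists_steps_batch {R K d₀ L σ ε : ℝ} (hR : 1 ≤ R) (hK : 0 ≤ K) (hd : 0 ≤ d₀)
    (hL : 0 < L) (hε : 0 < ε) :
    ∃ T S : ℕ, 0 < S ∧
      (2 * T : ℝ) * S ≤ 10000 * (R * max 1 (Real.log (K * d₀ / ε))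
        * max 1 (R * K ^ 2 * σ ^ 2 / (L ^ 2 * ε ^ 2))) ∧
      K ^ 2 * (1 - (1 / 40) / R) ^ (2 * T) * d₀ ^ 2 + 13 * R * K ^ 2 * σ ^ 2 / (L ^ 2 * S)
        ≤ ε ^ 2 := by
  set ℓ := max 1 (Real.log (K * d₀ / ε)) with hℓ
  set b := max 1 (R * K ^ 2 * σ ^ 2 / (L ^ 2 * ε ^ 2)) with hb
  have hℓ1 : 1 ≤ ℓ := le_max_left _ _
  have hb1 : 1 ≤ b := le_max_left _ _
  have hRℓ : 1 ≤ R * ℓ := by nlinarith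
  have hT := Nat.le_ceil (80 * R * ℓ)
  have hT' := Nat.ceil_lt_add_one (a := 80 * R * ℓ) (by positivity)
  have hS := Nat.le_ceil (26 * b)
  have hS' := Nat.ceil_lt_add_one (a := 26 * b) (by positivity)
  -- `T` brings the initial-error term below `ε²/4`, and `26 = 2 · 13` brings the noise term below
  -- `ε²/2`. Rounding up adds at most `1 ≤ Rℓ` and `1 ≤ b`, so the EG cost is at most `2 · 81 · 27 =
  -- 4374` times the claimed product.
  set T := ⌈80 * R * ℓ⌉₊
  set S := ⌈26 * b⌉₊
  have hS0 : (0 : ℝ) < S := by linarith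
  refine ⟨T, S, by exact_mod_cast hS0, ?_, ?_⟩
  · have h1 : (T : ℝ) ≤ 81 * (R * ℓ) := by linarith
    have h2 : (S : ℝ) ≤ 27 * b := by linarith
    calc (2 * T : ℝ) * S ≤ (2 * (81 * (R * ℓ))) * (27 * b) := by gcongr
      _ = 4374 * (R * ℓ * b) := by ring
      _ ≤ _ := by gcongr; norm_num
  · have h1 : K ^ 2 * (1 - (1 / 40) / R) ^ (2 * T) * d₀ ^ 2 ≤ ε ^ 2 / 4 := by
      have h3 := mul_pow_le_half hR (y := K * d₀ / ε) (by positivity) hT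
      have h0 : 0 ≤ K * d₀ / ε * (1 - (1 / 40) / R) ^ T := by
        have : 0 ≤ 1 - (1 / 40) / R := by
          rw [sub_nonneg, div_le_one (by linarith)]
          linarith
        positivity
      calc K ^ 2 * (1 - (1 / 40) / R) ^ (2 * T) * d₀ ^ 2
          = (K * d₀ / ε * (1 - (1 / 40) / R) ^ T) ^ 2 * ε ^ 2 := by
            rw [mul_comm 2 T, pow_mul]
            field_simp
        _ ≤ (1 / 2) ^ 2 * ε ^ 2 := by gcongr
        _ = _ := by ring
    have h2 : 13 * R * K ^ 2 * σ ^ 2 / (L ^ 2 * S) ≤ ε ^ 2 / 2 := by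
      have h4 : R * K ^ 2 * σ ^ 2 / (L ^ 2 * ε ^ 2) ≤ b := le_max_right _ _
      rw [div_le_iff₀ (by positivity)] at h4 ⊢
      calc 13 * R * K ^ 2 * σ ^ 2 ≤ 13 * (b * (L ^ 2 * ε ^ 2)) := by linarith
        _ = (26 * b) * (L ^ 2 * ε ^ 2 / 2) := by ring
        _ ≤ S * (L ^ 2 * ε ^ 2 / 2) := by gcongr
        _ = _ := by ring
    have : 0 ≤ ε ^ 2 := by positivity
    linarith

theorem integral_le_of_integral_sq_le {Ω : Type u} [MeasurableSpace Ω] {ν : Measure Ω}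
    [IsProbabilityMeasure ν] {X : Ω → ℝ} {ε : ℝ} (hX : ∀ ω, 0 ≤ X ω) (hε : 0 < ε)
    (hi : Integrable (fun ω => X ω ^ 2) ν) (h : ∫ ω, X ω ^ 2 ∂ν ≤ ε ^ 2) :
    Integrable X ν ∧ ∫ ω, X ω ∂ν ≤ ε := by
  have hmeas : AEStronglyMeasurable X ν := by
    have : X = fun ω => Real.sqrt (X ω ^ 2) := funext fun ω => (Real.sqrt_sq (hX ω)).symm
    rw [this]
    exact Real.continuous_sqrt.comp_aestronglyMeasurable hi.1
  have hint : Integrable X ν := ((memLp_two_iff_integrable_sq hmeas).mpr hi).integrable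
    (by norm_num)
  refine ⟨hint, ?_⟩
  -- Integrating `2εX ≤ X² + ε²` plays the role of Jensen's inequality.
  have h1 : ∫ ω, 2 * ε * X ω ∂ν ≤ ∫ ω, (X ω ^ 2 + ε ^ 2) ∂ν :=
    integral_mono (hint.const_mul _) (hi.add (integrable_const _)) fun ω => by
      nlinarith [sq_nonneg (X ω - ε)]
  rw [integral_const_mul, integral_add hi (integrable_const _)] at h1
  simp only [integral_const, probReal_univ, one_smul] at h1
  refine le_of_mul_le_mul_left ?_ (by positivity : 0 < 2 * ε)
  nlinarith

end Complexity

end QuadMinimax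

end

theorem theorem6 :
    -- The convergence bound, with numerical constants `c₁` and `c₂`.
    (∃ c₁ c₂ : ℝ, 0 < c₁ ∧ c₁ ≤ 1 ∧ 0 < c₂ ∧
      ∀ (n m : ℕ), 0 < n → 0 < m →
      ∀ (A : Matrix (Fin m) (Fin m) ℝ) (B : Matrix (Fin n) (Fin m) ℝ)
        (C : Matrix (Fin n) (Fin n) ℝ) (zs z₀ : QuadMinimax.Eucl n × QuadMinimax.Eucl m)
        (L μ μx r : ℝ),
        QuadMinimax.IsQuadNCSC A B C L μ μx → 2 * (L / μ) ≤ r →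
      ∀ (P J : Matrix (Fin (n + m)) (Fin (n + m)) ℂ) (δ : ℝ), 0 < δ → δ ≤ μx / 64 →
        QuadMinimax.IsJordanDecomp (QuadMinimax.matM A B C r) P J δ →
      ∀ (σ : ℝ) (S : ℕ), 0 ≤ σ → 0 < S →
      ∀ (Ω : Type u) [MeasurableSpace Ω] (ν : Measure Ω) [IsProbabilityMeasure ν]
        (g : QuadMinimax.Oracle Ω n m),
        -- stochastic GDA
        (QuadMinimax.NoiseAssumption ν
            (QuadMinimax.gradNoise (QuadMinimax.quadFun A B C zs) g
              (QuadMinimax.sgda g (1 / (4 * r * L)) (1 / (4 * L)) z₀)) σ S →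
          ∀ T : ℕ,
            Integrable (fun ω => QuadMinimax.dist2
              (QuadMinimax.sgda g (1 / (4 * r * L)) (1 / (4 * L)) z₀ T ω) zs ^ 2) ν ∧
            ∫ ω, QuadMinimax.dist2
                (QuadMinimax.sgda g (1 / (4 * r * L)) (1 / (4 * L)) z₀ T ω) zs ^ 2 ∂ν
              ≤ QuadMinimax.condNum P ^ 2 * (1 - c₁ / (r * (L / μx))) ^ (2 * T)
                  * QuadMinimax.dist2 z₀ zs ^ 2
                + c₂ * r * (L / μx) * QuadMinimax.condNum P ^ 2 * σ ^ 2 / (L ^ 2 * S)) ∧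
        -- stochastic EG
        (QuadMinimax.NoiseAssumption ν
            (QuadMinimax.gradNoise (QuadMinimax.quadFun A B C zs) g
              (QuadMinimax.segQuery g (1 / (4 * r * L)) (1 / (4 * L)) z₀)) σ S →
          ∀ T : ℕ,
            Integrable (fun ω => QuadMinimax.dist2
              (QuadMinimax.seg g (1 / (4 * r * L)) (1 / (4 * L)) z₀ T ω) zs ^ 2) ν ∧
            ∫ ω, QuadMinimax.dist2
                (QuadMinimax.seg g (1 / (4 * r * L)) (1 / (4 * L)) z₀ T ω) zs ^ 2 ∂ν
              ≤ QuadMinimax.condNum P ^ 2 * (1 - c₁ / (r * (L / μx))) ^ (2 * T)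
                  * QuadMinimax.dist2 z₀ zs ^ 2
                + c₂ * r * (L / μx) * QuadMinimax.condNum P ^ 2 * σ ^ 2 / (L ^ 2 * S))) ∧
    -- The gradient complexity, with a numerical constant `c₃`: a number of steps `T` and a batch
    -- size `S` that suffice for every oracle of that batch size, and their total cost
    -- (`S` gradient evaluations per oracle call; one call per GDA step, two calls per EG step).
    (∃ c₃ : ℝ, 0 < c₃ ∧
      ∀ (n m : ℕ), 0 < n → 0 < m →
      ∀ (A : Matrix (Fin m) (Fin m) ℝ) (B : Matrix (Fin n) (Fin m) ℝ)
        (C : Matrix (Fin n) (Fin n) ℝ) (zs z₀ : QuadMinimax.Eucl n × QuadMinimax.Eucl m)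
        (L μ μx r : ℝ),
        QuadMinimax.IsQuadNCSC A B C L μ μx → 2 * (L / μ) ≤ r →
      ∀ (P J : Matrix (Fin (n + m)) (Fin (n + m)) ℂ) (δ : ℝ), 0 < δ → δ ≤ μx / 64 →
        QuadMinimax.IsJordanDecomp (QuadMinimax.matM A B C r) P J δ →
      ∀ (σ ε : ℝ), 0 ≤ σ → 0 < ε →
        -- stochastic GDA
        (∃ T S : ℕ, 0 < S ∧
          (T : ℝ) * S ≤ c₃ * (r * (L / μx)
            * max 1 (Real.log (QuadMinimax.condNum P * QuadMinimax.dist2 z₀ zs / ε))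
            * max 1 (r * (L / μx) * QuadMinimax.condNum P ^ 2 * σ ^ 2 / (L ^ 2 * ε ^ 2))) ∧
          ∀ (Ω : Type u) [MeasurableSpace Ω] (ν : Measure Ω) [IsProbabilityMeasure ν]
            (g : QuadMinimax.Oracle Ω n m),
            QuadMinimax.NoiseAssumption ν
              (QuadMinimax.gradNoise (QuadMinimax.quadFun A B C zs) g
                (QuadMinimax.sgda g (1 / (4 * r * L)) (1 / (4 * L)) z₀)) σ S →
            Integrable (fun ω => QuadMinimax.dist2
              (QuadMinimax.sgda g (1 / (4 * r * L)) (1 / (4 * L)) z₀ T ω) zs) ν ∧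
            ∫ ω, QuadMinimax.dist2
              (QuadMinimax.sgda g (1 / (4 * r * L)) (1 / (4 * L)) z₀ T ω) zs ∂ν ≤ ε) ∧
        -- stochastic EG
        (∃ T S : ℕ, 0 < S ∧
          (2 * T : ℝ) * S ≤ c₃ * (r * (L / μx)
            * max 1 (Real.log (QuadMinimax.condNum P * QuadMinimax.dist2 z₀ zs / ε))
            * max 1 (r * (L / μx) * QuadMinimax.condNum P ^ 2 * σ ^ 2 / (L ^ 2 * ε ^ 2))) ∧
          ∀ (Ω : Type u) [MeasurableSpace Ω] (ν : Measure Ω) [IsProbabilityMeasure ν]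
            (g : QuadMinimax.Oracle Ω n m),
            QuadMinimax.NoiseAssumption ν
              (QuadMinimax.gradNoise (QuadMinimax.quadFun A B C zs) g
                (QuadMinimax.segQuery g (1 / (4 * r * L)) (1 / (4 * L)) z₀)) σ S →
            Integrable (fun ω => QuadMinimax.dist2
              (QuadMinimax.seg g (1 / (4 * r * L)) (1 / (4 * L)) z₀ T ω) zs) ν ∧
            ∫ ω, QuadMinimax.dist2
              (QuadMinimax.seg g (1 / (4 * r * L)) (1 / (4 * L)) z₀ T ω) zs ∂ν ≤ ε)) := by
  constructor
  · refine ⟨1 / 40, 13, by norm_num, by norm_num, by norm_num, ?_⟩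
    intro n m _ hm A B C zs z₀ L μ μx r hq hr P J δ hδ hδ' hJ σ S _ _ Ω _ ν _ g
    have h : QuadMinimax.IsJordanSetting A B C L μ μx r P J δ := ⟨hq, hm, hr, hδ, hδ', hJ⟩
    exact ⟨fun hN T => h.sgda_bound hN T, fun hN T => h.seg_bound hN T⟩
  · refine ⟨10000, by norm_num, ?_⟩
    intro n m _ hm A B C zs z₀ L μ μx r hq hr P J δ hδ hδ' hJ σ ε _ hε
    have h : QuadMinimax.IsJordanSetting A B C L μ μx r P J δ := ⟨hq, hm, hr, hδ, hδ', hJ⟩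
    have hK : 0 ≤ QuadMinimax.condNum P := mul_nonneg (norm_nonneg _) (norm_nonneg _)
    obtain ⟨T, S, hS, hcost, hacc⟩ := QuadMinimax.exists_steps_batch (σ := σ)
      h.one_le_rate_inv hK (norm_nonneg _ : 0 ≤ QuadMinimax.dist2 z₀ zs) hq.L_pos hε
    rw [← mul_assoc 13] at hacc
    -- `T` and `S` are fixed before any oracle appears, and the same pair serves both algorithms;
    -- the cost bound is the one for EG, twice that of GDA.
    refine ⟨⟨T, S, hS, le_trans ?_ hcost, ?_⟩, ⟨T, S, hS, hcost, ?_⟩⟩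
    · have : (0 : ℝ) ≤ T * S := by positivity
      linarith
    · intro Ω _ ν _ g hN
      obtain ⟨hi, hb⟩ := h.sgda_bound hN T
      exact QuadMinimax.integral_le_of_integral_sq_le (fun _ => norm_nonneg _) hε hi
        (hb.trans hacc)
    · intro Ω _ ν _ g hN
      obtain ⟨hi, hb⟩ := h.seg_bound hN T
      exact QuadMinimax.integral_le_of_integral_sq_le (fun _ => norm_nonneg _) hε hi
        (hb.trans hacc)
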